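/- **Theorem 2 (Multiple tokens).** Let $\sigma, L>0$, let $f_1,\dots,f_n:\mathbb{R}^d\to\mathbb{R}$ be convex, differentiable and $L$-smooth ($\nabla f_i$ is $L$-Lipschitz), let $\theta_\star$ be the minimizer of $\sum_{i=1}^n\big[f_i(\theta)+\frac{\sigma}{2}\|\theta\|^2\big]$, and let $\kappa=1+L/\sigma$. Let $1\le K\le n$ and $p_{\rm comp}=p_{\rm comm}=\frac12$. Consider *Token Gradient Descent* on the complete graph with $n$ nodes. Its parameters are $$\tilde\sigma=\tfrac{n}{n+K}\sigma,\quad \eta=\min\Big(\tfrac{\tilde\sigma p_{\rm comm}}{2nK},\tfrac{p_{\rm comp}}{n\alpha(1+L/\tilde\sigma)}\Big),\quad \rho_{\rm comm}=\tfrac{nK\eta}{p_{\rm comm}\tilde\sigma},\quad \rho_{\rm comp}=\tfrac{n\alpha\eta}{p_{\rm comp}},$$ where either $\alpha=\frac{2K}{L+\tilde\sigma}$, or $L\ge\sigma$ and $\alpha=\frac{2K}{L}$. Given an arbitrary $z_0\in(\mathbb{R}^d)^n$, set $\theta_0^{(i)}=-\nabla f_i(z_0^{(i)})/\tilde\sigma$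 for every node $i$ and $\theta_0^{{\rm token},k}=0$ for every token $k$. At each iteration $t$, independently of the past: - with probability $p_{\rm comm}$, draw a node $i$ and a token $k$ uniformly at random; token $k$ jumps to node $i$, and $\theta_{t+1}^{{\rm token},k}=\theta_t^{{\rm token},k}-\rho_{\rm comm}(\theta_t^{{\rm token},k}-\theta_t^{(i)})$, $\theta_{t+1}^{(i)}=\theta_t^{(i)}+\rho_{\rm comm}(\theta_t^{{\rm token},k}-\theta_t^{(i)})$; - with probability $p_{\rm comp}$, draw a node $i$ uniformly at random; it performs a gradient step $z_{t+1}^{(i)}=(1-\rho_{\rm comp})z_t^{(i)}+\rho_{\rm comp}\theta_t^{(i)}$, $\theta_{t+1}^{(i)}=\theta_t^{(i)}-\frac1{\tilde\sigma}\big(\nabla f_i(z_{t+1}^{(i)})-\nabla f_i(z_t^{(i)})\big)$; all other variables are unchanged. Let $D_0=\kappa^2\sum_i\|z_0^{(i)}-\theta_\star\|^2+\sum_i\|\theta_\star+\nabla f_i(\theta_\star)/\sigma\|^2+n\|\theta_\star\|^2$ and $\log^+x=\max(0,\log x)$, with $\log^+0=0$. There is a universal constant $C>0$ such that, for all data as above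 and all $\varepsilon>0$, there is a (deterministic) number of iterations $T$ with $\mathbb{E}\|\theta_t^{{\rm token},k}-\theta_\star\|^2\le\varepsilon$ for all $t\ge T$ and all tokens $k$, such that, during the first $T$ iterations, 1. the expected number of gradient steps of each node is at most $C\,\kappa\,\big(1+\log^+(D_0/\varepsilon)\big)$; 2. the expected number of jumps of each token is at most $C\,\frac nK\,\kappa\,\big(1+\log^+(D_0/\varepsilon)\big)$; 3. the expected total number of jumps of all tokens is at most $C\,n\,\kappa\,\big(1+\log^+(D_0/\varepsilon)\big)$, a bound that does not depend on $K$ and is thus the same as for one token, and each token performs a fraction $1/K$ of it in expectation. In particular, $T_{\rm comp}=O(\kappa\log\varepsilon^{-1})$ and $T_{\rm comm}=O(\frac nK\kappa\log\varepsilon^{-1})$ as $\varepsilon\to0$, with universal constants. -/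

import Mathlib

open MeasureTheory ProbabilityTheory

noncomputable section

namespace TokenGD

/-- The parameter space `ℝ^d` with its Euclidean norm. -/
abbrev Vec (d : ℕ) : Type := EuclideanSpace ℝ (Fin d)

/-- `f` is `L`-smooth on `ℝ^d`: differentiable with `L`-Lipschitz gradient. -/
def LSmooth {d : ℕ} (L : ℝ) (f : Vec d → ℝ) : Prop :=
  Differentiable ℝ f ∧ ∀ x y : Vec d, ‖gradient f x - gradient f y‖ ≤ L * ‖x - y‖

/-- The global objective `θ ↦ ∑ᵢ (fᵢ(θ) + (σ/2) ‖θ‖²)`. -/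
def objective {d n : ℕ} (σ : ℝ) (f : Fin n → Vec d → ℝ) (θ : Vec d) : ℝ :=
  ∑ i, (f i θ + σ / 2 * ‖θ‖ ^ 2)

/-- The condition number `κ = 1 + L / σ`. -/
def condNumber (L σ : ℝ) : ℝ := 1 + L / σ

/-! ### Parameters of the algorithm -/

/-- `σ̃ = n σ / (n + K)`. -/
def sigmaTilde (n K : ℕ) (σ : ℝ) : ℝ := (n : ℝ) / ((n : ℝ) + K) * σ

/-- The step-size
`η = min (σ̃ p_comm / (2 n K), p_comp / (n α (1 + L / σ̃)))`. -/
def eta (n K : ℕ) (σ L α pcomm pcomp : ℝ) : ℝ :=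
  min (sigmaTilde n K σ * pcomm / (2 * n * K))
    (pcomp / (n * α * (1 + L / sigmaTilde n K σ)))

/-- `ρ_comm = n K η / (p_comm σ̃)`. -/
def rhoComm (n K : ℕ) (σ L α pcomm pcomp : ℝ) : ℝ :=
  n * K * eta n K σ L α pcomm pcomp / (pcomm * sigmaTilde n K σ)

/-- `ρ_comp = n α η / p_comp`. -/
def rhoComp (n K : ℕ) (σ L α pcomm pcomp : ℝ) : ℝ :=
  n * α * eta n K σ L α pcomm pcomp / pcomp

/-! ### The algorithm -/

/-- What happens in one iteration: `comm i k` means that token `k` jumps to node `i`, and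
`comp i` means that node `i` performs a local gradient step. -/
inductive Action (n K : ℕ) : Type where
  | comm (i : Fin n) (k : Fin K) : Action n K
  | comp (i : Fin n) : Action n K

instance (n K : ℕ) : MeasurableSpace (Action n K) := ⊤

/-- The state of the algorithm: local parameters `θ⁽ⁱ⁾`, virtual parameters `z⁽ⁱ⁾` and
token parameters `θ^{token,k}`. -/
structure State (d n K : ℕ) : Type where
  node : Fin n → Vec d
  virt : Fin n → Vec d
  token : Fin K → Vec d

/-- Initial state: `z₀` is given, `θ₀⁽ⁱ⁾ = - ∇fᵢ(z₀⁽ⁱ⁾) / σ̃` and `θ₀^{token,k} = 0`. -/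
def initState {d n : ℕ} (K : ℕ) (σ : ℝ) (f : Fin n → Vec d → ℝ) (z₀ : Fin n → Vec d) :
    State d n K where
  node := fun i => -((sigmaTilde n K σ)⁻¹ • gradient (f i) (z₀ i))
  virt := z₀
  token := fun _ => 0

/-- Communication step between node `i` and token `k` with weight `ρ`. -/
def commStep {d n K : ℕ} (ρ : ℝ) (i : Fin n) (k : Fin K) (s : State d n K) : State d n K where
  node := Function.update s.node i (s.node i + ρ • (s.token k - s.node i))
  virt := s.virt
  token := Function.update s.token k (s.token k - ρ • (s.token k - s.node i))

/-- The new virtual parameter `(1 - ρ) z⁽ⁱ⁾ + ρ θ⁽ⁱ⁾` of node `i`. -/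
def newVirt {d n K : ℕ} (ρ : ℝ) (i : Fin n) (s : State d n K) : Vec d :=
  (1 - ρ) • s.virt i + ρ • s.node i

/-- Computation (local gradient) step at node `i` with weight `ρ`. -/
def compStep {d n K : ℕ} (σ ρ : ℝ) (f : Fin n → Vec d → ℝ) (i : Fin n) (s : State d n K) :
    State d n K where
  node := Function.update s.node i
    (s.node i - (sigmaTilde n K σ)⁻¹ •
      (gradient (f i) (newVirt ρ i s) - gradient (f i) (s.virt i)))
  virt := Function.update s.virt i (newVirt ρ i s)
  token := s.token

/-- One iteration of Token Gradient Descent. -/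
def step {d n K : ℕ} (σ L α pcomm pcomp : ℝ) (f : Fin n → Vec d → ℝ) :
    Action n K → State d n K → State d n K
  | .comm i k, s => commStep (rhoComm n K σ L α pcomm pcomp) i k s
  | .comp i, s => compStep σ (rhoComp n K σ L α pcomm pcomp) f i s

/-- The iterates of Token Gradient Descent along a sequence of actions. -/
def iterate {d n K : ℕ} (σ L α pcomm pcomp : ℝ) (f : Fin n → Vec d → ℝ)
    (z₀ : Fin n → Vec d) (a : ℕ → Action n K) : ℕ → State d n K
  | 0 => initState K σ f z₀
  | t + 1 => step σ L α pcomm pcomp f (a t) (iterate σ L α pcomm pcomp f z₀ a t)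

/-- The actions `a 0, a 1, …` are sampled as in Token Gradient Descent on the complete graph:
independently over time; with probability `p_comm` a communication step between a uniform node
and a uniform token, with probability `p_comp` a computation step at a uniform node. -/
structure IsSampling {Ω : Type*} [MeasurableSpace Ω] (P : Measure Ω) {n K : ℕ}
    (pcomm pcomp : ℝ) (a : ℕ → Ω → Action n K) : Prop where
  measurable : ∀ t, Measurable (a t)
  indep : iIndepFun a P
  comm_prob : ∀ t i k, P.real {ω | a t ω = Action.comm i k} = pcomm / (n * K)
  comp_prob : ∀ t i, P.real {ω | a t ω = Action.comp i} = pcomp / n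

/-! ### Complexity counters -/

open Classical in
/-- Number of gradient steps performed by node `i` during the first `T` iterations. -/
def gradSteps {n K : ℕ} (a : ℕ → Action n K) (i : Fin n) (T : ℕ) : ℕ :=
  ((Finset.range T).filter fun t => a t = Action.comp i).card

open Classical in
/-- Number of jumps performed by token `k` during the first `T` iterations. -/
def tokenJumps {n K : ℕ} (a : ℕ → Action n K) (k : Fin K) (T : ℕ) : ℕ :=
  ((Finset.range T).filter fun t => ∃ i, a t = Action.comm i k).card

open Classical in
/-- Total number of communications (jumps of any token) during the first `T` iterations. -/
def totalComms {n K : ℕ} (a : ℕ → Action n K) (T : ℕ) : ℕ :=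
  ((Finset.range T).filter fun t => ∃ i k, a t = Action.comm i k).card

/-- The initial gap
`D₀ = κ² ∑ᵢ ‖z₀⁽ⁱ⁾ - θ⋆‖² + ∑ᵢ ‖θ⋆ + ∇fᵢ(θ⋆) / σ‖² + n ‖θ⋆‖²`. -/
def initGap {d n : ℕ} (σ L : ℝ) (f : Fin n → Vec d → ℝ) (z₀ : Fin n → Vec d)
    (θs : Vec d) : ℝ :=
  condNumber L σ ^ 2 * ∑ i, ‖z₀ i - θs‖ ^ 2
    + ∑ i, ‖θs + σ⁻¹ • gradient (f i) θs‖ ^ 2 + n * ‖θs‖ ^ 2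

end TokenGD

end

/-!
Token Gradient Descent is a randomized Bregman coordinate descent on the dual of the problem in
which every node and every token holds its own copy of the parameter, subject to the equality of
the copies along the edges of the complete bipartite graph between nodes and tokens. Write `μ` for
`σ̃`, `u` and `v` for the differences of node and token parameters to the minimizer, `S` for
`∑ ‖uᵢ‖² + ∑ ‖vₖ‖²` (`sqDist`), and `D_f` for Bregman divergences. The dual gap is
`E = μ/2 S + ∑ D_{fᵢ}(θs, z⁽ⁱ⁾)` (`dualGap`), and the proof follows the Lyapunov function
`Φ = Q / 2 + A / α + 4 η n E` (`lyapunov`). Here `A = ∑ D_{fᵢ}(z⁽ⁱ⁾, θs)` is the Bregman distance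
of the gradient coordinates to their optimum, and `Q` is the energy of the communication
coordinates. For the complete bipartite graph the pseudo-inverse of the Laplacian is explicit, and
so is `Q` (`flowEnergy`).

In expectation over one iteration, `Q / 2 + A / α` changes by `-η (μ S + A + B)`, where
`B = ∑ D_{fᵢ}(θs, z⁽ⁱ⁾)`, plus second-order terms: the inner products of gradients and parameters
that come from the two kinds of steps cancel. The step-sizes are such that `E` decreases at every
step, by enough to absorb the second-order terms: for communications because `ρ_comm ≤ 1/2`, for
computations by cocoercivity of the gradients and `ρ_comp (1 + L / μ) ≤ 1`
(`dualGap_compStep_le`). This gives `lyapunov_mean_le`. Since `Φ ≤ 3 (L + μ) / K * (μ S + A + B)`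
(`lyapunov_le`) and `η` is of order `μ / (n K)`, the expectation of `Φ` contracts by
`1 - 1 / (48 n κ)` (`integral_lyapunov_succ_le`).

Finally `4 K Φ / μ²` bounds the squared error of each token and is initially at most `48 D₀`
(`lyapunov_initState_le`), so `n κ (1 + log⁺ (D₀ / ε))` iterations suffice, up to a constant. An
iteration is a gradient step of a given node with probability `1 / (2 n)`, a jump of a given token
with probability `1 / (2 K)`, and a communication with probability `1 / 2`.
-/

namespace TokenGD

/-! ### Bregman divergences of smooth convex functions -/

section Bregman

variable {F : Type*} [NormedAddCommGroup F] [InnerProductSpace ℝ F] [CompleteSpace F]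

/-- The Bregman divergence `D_f(x, y) = f x - f y - ⟨∇f(y), x - y⟩`. -/
noncomputable def bregman (f : F → ℝ) (x y : F) : ℝ := f x - f y - inner ℝ (gradient f y) (x - y)

lemma bregman_add_swap (f : F → ℝ) (x y : F) :
    bregman f x y + bregman f y x = inner ℝ (gradient f x - gradient f y) (x - y) := by
  unfold bregman
  rw [← neg_sub x y, inner_neg_right, inner_sub_left]
  ring

lemma bregman_three_point (f : F → ℝ) (w x y : F) :
    bregman f w y
      = bregman f x y + inner ℝ (gradient f x - gradient f y) (w - x) + bregman f w x := by
  unfold bregman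
  simp only [inner_sub_left, inner_sub_right]
  ring

lemma hasDerivAt_comp_segment {f : F → ℝ} (hf : Differentiable ℝ f) (y v : F) (t : ℝ) :
    HasDerivAt (fun t : ℝ => f (y + t • v)) (inner ℝ (gradient f (y + t • v)) v) t := by
  have h1 : HasDerivAt (fun t : ℝ => y + t • v) v t := by
    simpa using ((hasDerivAt_id t).smul_const v).const_add y
  have h2 := (hf (y + t • v)).hasGradientAt.hasFDerivAt.comp_hasDerivAt t h1
  rw [InnerProductSpace.toDual_apply_apply] at h2
  exact h2

lemma bregman_nonneg {f : F → ℝ} (hc : ConvexOn ℝ Set.univ f) (hf : Differentiable ℝ f)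
    (x y : F) : 0 ≤ bregman f x y := by
  have hd := hasDerivAt_comp_segment hf y (x - y) 0
  have hφ : ConvexOn ℝ Set.univ (fun t : ℝ => f (y + t • (x - y))) := by
    have := hc.comp_affineMap (AffineMap.lineMap (k := ℝ) y x)
    refine (this.subset (Set.subset_univ _) convex_univ).congr ?_
    intro t _
    simp [AffineMap.lineMap_apply, add_comm]
  have h := hφ.le_slope_of_hasDerivAt (Set.mem_univ 0) (Set.mem_univ 1) one_pos hd
  simp only [slope_def_field, zero_smul, add_zero, one_smul, add_sub_cancel, sub_zero,
    div_one] at h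
  unfold bregman
  linarith

lemma bregman_le {f : F → ℝ} {L : ℝ} (hf : Differentiable ℝ f)
    (hL : ∀ x y : F, ‖gradient f x - gradient f y‖ ≤ L * ‖x - y‖) (x y : F) :
    bregman f x y ≤ L / 2 * ‖x - y‖ ^ 2 := by
  set v := x - y with hv
  let h : ℝ → ℝ := fun t => f (y + t • v) - t * inner ℝ (gradient f y) v
    - L / 2 * ‖v‖ ^ 2 * t ^ 2
  have hd : ∀ t, HasDerivAt h (inner ℝ (gradient f (y + t • v)) v
      - inner ℝ (gradient f y) v - L / 2 * ‖v‖ ^ 2 * (2 * t)) t := by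
    intro t
    have := ((hasDerivAt_comp_segment hf y v t).sub
      ((hasDerivAt_id t).mul_const (inner ℝ (gradient f y) v))).sub
      ((hasDerivAt_pow 2 t).const_mul (L / 2 * ‖v‖ ^ 2))
    simp only [one_mul, Nat.cast_ofNat, Nat.add_one_sub_one, pow_one] at this
    exact this
  have hanti : AntitoneOn h (Set.Icc 0 1) := by
    refine antitoneOn_of_deriv_nonpos (convex_Icc 0 1)
      (fun t _ => (hd t).continuousAt.continuousWithinAt)
      (fun t _ => (hd t).differentiableAt.differentiableWithinAt) ?_
    intro t ht
    rw [interior_Icc] at ht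
    rw [(hd t).deriv, ← inner_sub_left]
    have h1 := real_inner_le_norm (gradient f (y + t • v) - gradient f y) v
    have h2 := hL (y + t • v) y
    rw [add_sub_cancel_left, norm_smul, Real.norm_of_nonneg ht.1.le] at h2
    have h3 := mul_le_mul_of_nonneg_right h2 (norm_nonneg v)
    nlinarith
  have h01 := hanti (Set.left_mem_Icc.2 zero_le_one) (Set.right_mem_Icc.2 zero_le_one) zero_le_one
  have hx : y + v = x := by simp [hv]
  simp only [h, one_smul, zero_smul, add_zero, hx] at h01
  unfold bregman
  rw [← hv]
  linarith

/-- Cocoercivity of the gradient, in its Bregman form: `D_f(·, y)` is nonnegative, and the descent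
lemma bounds its value at the gradient step `x - (∇f(x) - ∇f(y)) / L` from above. -/
lemma norm_gradient_sub_sq_le {f : F → ℝ} {L : ℝ} (hLpos : 0 < L)
    (hc : ConvexOn ℝ Set.univ f) (hf : Differentiable ℝ f)
    (hL : ∀ x y : F, ‖gradient f x - gradient f y‖ ≤ L * ‖x - y‖) (x y : F) :
    ‖gradient f x - gradient f y‖ ^ 2 ≤ 2 * L * bregman f x y := by
  set g := gradient f x - gradient f y with hg
  have h0 := bregman_nonneg hc hf (x - L⁻¹ • g) y
  have h1 := bregman_le hf hL (x - L⁻¹ • g) x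
  rw [bregman_three_point f _ x y, ← hg] at h0
  simp only [sub_sub_cancel_left, inner_neg_right, inner_smul_right,
    real_inner_self_eq_norm_sq, norm_neg, norm_smul, mul_pow, Real.norm_eq_abs, sq_abs] at h0 h1
  have h2 : L / 2 * (L⁻¹ ^ 2 * ‖g‖ ^ 2) = L⁻¹ * ‖g‖ ^ 2 / 2 := by field_simp
  have h3 : L⁻¹ * ‖g‖ ^ 2 ≤ 2 * bregman f x y := by linarith
  have h4 := mul_le_mul_of_nonneg_left h3 hLpos.le
  rw [mul_inv_cancel_left₀ hLpos.ne'] at h4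
  linarith

lemma norm_gradient_sub_sq_le_swap {f : F → ℝ} {L : ℝ} (hLpos : 0 < L)
    (hc : ConvexOn ℝ Set.univ f) (hf : Differentiable ℝ f)
    (hL : ∀ x y : F, ‖gradient f x - gradient f y‖ ≤ L * ‖x - y‖) (x y : F) :
    ‖gradient f x - gradient f y‖ ^ 2 ≤ 2 * L * bregman f y x := by
  rw [← norm_neg, neg_sub]
  exact norm_gradient_sub_sq_le hLpos hc hf hL y x

end Bregman

/-- First-order optimality of the minimizer of the global objective. -/
lemma sum_gradient_minimizer {d n : ℕ} {σ : ℝ} {f : Fin n → Vec d → ℝ}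
    (hf : ∀ i, Differentiable ℝ (f i)) {θs : Vec d}
    (hθs : IsMinOn (objective σ f) Set.univ θs) :
    ∑ i, gradient (f i) θs + (n * σ) • θs = 0 := by
  have hmin : IsLocalMin (objective σ f) θs := hθs.isLocalMin Filter.univ_mem
  have hd : HasFDerivAt (objective σ f)
      (∑ i, (InnerProductSpace.toDual ℝ (Vec d) (gradient (f i) θs)
        + (σ / 2) • (2 • innerSL ℝ θs))) θs := by
    refine HasFDerivAt.fun_sum fun i _ => ?_
    exact ((hf i) θs).hasGradientAt.hasFDerivAt.add
      (((hasStrictFDerivAt_norm_sq θs).hasFDerivAt).const_mul (σ / 2))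
  have h0 := hmin.hasFDerivAt_eq_zero hd
  refine ext_inner_right ℝ fun w => ?_
  have hw := congrArg (fun l : Vec d →L[ℝ] ℝ => l w) h0
  simp only [sum_apply, add_apply,
    smul_apply, InnerProductSpace.toDual_apply_apply, innerSL_apply_apply,
    zero_apply, Finset.sum_add_distrib, Finset.sum_const, Finset.card_univ,
    Fintype.card_fin, nsmul_eq_mul, smul_eq_mul] at hw
  rw [inner_add_left, sum_inner, inner_smul_left, inner_zero_left, ← hw]
  simp only [conj_trivial]
  push_cast
  ring

/-! ### The Lyapunov function -/

lemma sum_comp_update {m : ℕ} {β M : Type*} [AddCommGroup M] (φ : Fin m → β → M)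
    (x : Fin m → β) (i : Fin m) (b : β) :
    ∑ j, φ j (Function.update x i b j) = ∑ j, φ j (x j) + (φ i b - φ i (x i)) := by
  rw [← Finset.add_sum_erase _ _ (Finset.mem_univ i),
    ← Finset.add_sum_erase _ (fun j => φ j (x j)) (Finset.mem_univ i)]
  have : ∑ j ∈ Finset.univ.erase i, φ j (Function.update x i b j)
      = ∑ j ∈ Finset.univ.erase i, φ j (x j) :=
    Finset.sum_congr rfl fun j hj => by
      rw [Function.update_of_ne (Finset.ne_of_mem_erase hj)]
  rw [this, Function.update_self]
  abel

section Lyapunov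

variable {d n K : ℕ}

/-- Squared distance of all the local and token parameters to `θs`. -/
noncomputable def sqDist (θs : Vec d) (s : State d n K) : ℝ :=
  ∑ i, ‖s.node i - θs‖ ^ 2 + ∑ k, ‖s.token k - θs‖ ^ 2

/-- `∑ᵢ D_{fᵢ}(z⁽ⁱ⁾, θs)`, which is the distance of the dual variables `∇fᵢ(z⁽ⁱ⁾)` to their optimal
values in the Bregman divergences of the conjugates `fᵢ*`. -/
noncomputable def virtGap (f : Fin n → Vec d → ℝ) (θs : Vec d) (s : State d n K) : ℝ :=
  ∑ i, bregman (f i) (s.virt i) θs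

/-- `∑ᵢ D_{fᵢ}(θs, z⁽ⁱ⁾)`, the divergences of `virtGap` with exchanged arguments. -/
noncomputable def virtGapSwap (f : Fin n → Vec d → ℝ) (θs : Vec d) (s : State d n K) : ℝ :=
  ∑ i, bregman (f i) θs (s.virt i)

/-- The suboptimality of the dual objective when `θs` is the minimizer. -/
noncomputable def dualGap (μ : ℝ) (f : Fin n → Vec d → ℝ) (θs : Vec d) (s : State d n K) : ℝ :=
  μ / 2 * sqDist θs s + virtGapSwap f θs s

/-- What node `i` received through communications (`μ θ⁽ⁱ⁾ + ∇fᵢ(z⁽ⁱ⁾)`), relative to its optimal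
value. -/
noncomputable def nodeFlow (μ : ℝ) (f : Fin n → Vec d → ℝ) (θs : Vec d) (s : State d n K)
    (i : Fin n) : Vec d :=
  μ • (s.node i - θs) + (gradient (f i) (s.virt i) - gradient (f i) θs)

/-- What token `k` received through communications, relative to its optimal value. -/
noncomputable def tokenFlow (μ : ℝ) (θs : Vec d) (s : State d n K) (k : Fin K) : Vec d :=
  μ • (s.token k - θs)

/-- For flows of total sum zero, this is the quadratic form `⟨x, 𝓛⁺ x⟩` of the pseudo-inverse of the
Laplacian `𝓛` of the complete bipartite graph between the nodes and the tokens, that is the energy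
of the communication variables carried by the edges. -/
noncomputable def flowEnergy (μ : ℝ) (f : Fin n → Vec d → ℝ) (θs : Vec d) (s : State d n K) : ℝ :=
  (∑ i, ‖nodeFlow μ f θs s i‖ ^ 2) / K + (∑ k, ‖tokenFlow μ θs s k‖ ^ 2) / n
    - ‖∑ i, nodeFlow μ f θs s i‖ ^ 2 / (n * K)

/-- The Lyapunov function: the energy of the dual variables plus a multiple of the dual gap. -/
noncomputable def lyapunov (μ α η : ℝ) (f : Fin n → Vec d → ℝ) (θs : Vec d) (s : State d n K) : ℝ :=
  flowEnergy μ f θs s / 2 + virtGap f θs s / α + 4 * η * n * dualGap μ f θs s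

lemma flowEnergy_le (μ : ℝ) (f : Fin n → Vec d → ℝ) (θs : Vec d) (s : State d n K) :
    flowEnergy μ f θs s
      ≤ (∑ i, ‖nodeFlow μ f θs s i‖ ^ 2) / K + (∑ k, ‖tokenFlow μ θs s k‖ ^ 2) / n := by
  unfold flowEnergy
  have : 0 ≤ ‖∑ i, nodeFlow μ f θs s i‖ ^ 2 / ((n : ℝ) * K) := by positivity
  linarith

lemma flowEnergy_nonneg (hn : 0 < n) (hK : 0 < K) (μ : ℝ) (f : Fin n → Vec d → ℝ) (θs : Vec d)
    (s : State d n K) : 0 ≤ flowEnergy μ f θs s := by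
  have hn' : (0 : ℝ) < n := Nat.cast_pos.2 hn
  have hK' : (0 : ℝ) < K := Nat.cast_pos.2 hK
  have h1 : ‖∑ i, nodeFlow μ f θs s i‖ ^ 2 ≤ n * ∑ i, ‖nodeFlow μ f θs s i‖ ^ 2 := by
    have h := sq_sum_le_card_mul_sum_sq (s := Finset.univ) (f := fun i => ‖nodeFlow μ f θs s i‖)
    rw [Finset.card_univ, Fintype.card_fin] at h
    exact (pow_le_pow_left₀ (norm_nonneg _) (norm_sum_le _ _) 2).trans h
  have h2 : ‖∑ i, nodeFlow μ f θs s i‖ ^ 2 / (n * K) ≤ (∑ i, ‖nodeFlow μ f θs s i‖ ^ 2) / K := by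
    rw [div_le_div_iff₀ (by positivity) hK']
    nlinarith
  have h3 : 0 ≤ (∑ k, ‖tokenFlow μ θs s k‖ ^ 2) / (n : ℝ) := by positivity
  unfold flowEnergy
  linarith

/-! ### Effect of a communication step -/

lemma sqDist_commStep (θs : Vec d) (ρ : ℝ) (i : Fin n) (k : Fin K) (s : State d n K) :
    sqDist θs (commStep ρ i k s)
      = sqDist θs s - 2 * ρ * (1 - ρ) * ‖s.token k - s.node i‖ ^ 2 := by
  unfold sqDist
  simp only [commStep]
  rw [sum_comp_update (fun _ w => ‖w - θs‖ ^ 2), sum_comp_update (fun _ w => ‖w - θs‖ ^ 2)]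
  have h1 : s.node i + ρ • (s.token k - s.node i) - θs
      = (s.node i - θs) + ρ • ((s.token k - θs) - (s.node i - θs)) := by
    rw [sub_sub_sub_cancel_right]; abel
  have h2 : s.token k - ρ • (s.token k - s.node i) - θs
      = (s.token k - θs) - ρ • ((s.token k - θs) - (s.node i - θs)) := by
    rw [sub_sub_sub_cancel_right]; abel
  rw [h1, h2, ← sub_sub_sub_cancel_right (s.token k) (s.node i) θs]
  simp only [← real_inner_self_eq_norm_sq, inner_add_left, inner_add_right, inner_sub_left,
    inner_sub_right, inner_smul_left, inner_smul_right, conj_trivial]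
  rw [real_inner_comm (s.token k) (s.node i), real_inner_comm θs (s.node i),
    real_inner_comm θs (s.token k)]
  ring

lemma nodeFlow_commStep (μ : ℝ) (f : Fin n → Vec d → ℝ) (θs : Vec d) (ρ : ℝ) (i : Fin n)
    (k : Fin K) (s : State d n K) :
    nodeFlow μ f θs (commStep ρ i k s) = Function.update (nodeFlow μ f θs s) i
      (nodeFlow μ f θs s i + (ρ * μ) • (s.token k - s.node i)) := by
  ext1 j
  by_cases hj : j = i
  · subst hj
    simp only [nodeFlow, commStep, Function.update_self]
    module
  · simp only [nodeFlow, commStep, Function.update_of_ne hj]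

lemma tokenFlow_commStep (μ : ℝ) (θs : Vec d) (ρ : ℝ) (i : Fin n)
    (k : Fin K) (s : State d n K) :
    tokenFlow μ θs (commStep ρ i k s) = Function.update (tokenFlow μ θs s) k
      (tokenFlow μ θs s k - (ρ * μ) • (s.token k - s.node i)) := by
  ext1 j
  by_cases hj : j = k
  · subst hj
    simp only [tokenFlow, commStep, Function.update_self]
    module
  · simp only [tokenFlow, commStep, Function.update_of_ne hj]

/-- The first-order change of half of `flowEnergy` when the edge between node `i` and token `k`
carries the difference of their parameters. -/
noncomputable def flowSlope (μ : ℝ) (f : Fin n → Vec d → ℝ) (θs : Vec d) (s : State d n K)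
    (i : Fin n) (k : Fin K) : ℝ :=
  inner ℝ (nodeFlow μ f θs s i) (s.token k - s.node i) / K
    - inner ℝ (tokenFlow μ θs s k) (s.token k - s.node i) / n
    - inner ℝ (∑ j, nodeFlow μ f θs s j) (s.token k - s.node i) / (n * K)

lemma flowEnergy_commStep (μ : ℝ) (f : Fin n → Vec d → ℝ) (θs : Vec d) (ρ : ℝ) (i : Fin n)
    (k : Fin K) (s : State d n K) :
    flowEnergy μ f θs (commStep ρ i k s) = flowEnergy μ f θs s
      + 2 * (ρ * μ) * flowSlope μ f θs s i k
      + (ρ * μ) ^ 2 * (1 / K + 1 / n - 1 / (n * K)) * ‖s.token k - s.node i‖ ^ 2 := by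
  unfold flowEnergy flowSlope
  rw [nodeFlow_commStep, tokenFlow_commStep]
  rw [sum_comp_update (fun _ w => ‖w‖ ^ 2), sum_comp_update (fun _ w => ‖w‖ ^ 2),
    sum_comp_update (fun _ w => w), add_sub_cancel_left]
  simp only [norm_add_sq_real, norm_sub_sq_real, inner_smul_right, norm_smul, mul_pow,
    Real.norm_eq_abs, sq_abs]
  ring

/-- Summing over all edges applies `𝓛⁺ 𝓛`, which is the identity up to constants, and the constants
do not matter because `(x, y)` has total sum zero. -/
lemma sum_edges_inner {V : Type*} [NormedAddCommGroup V] [InnerProductSpace ℝ V]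
    (hn : 0 < n) (hK : 0 < K) (x u : Fin n → V) (y v : Fin K → V)
    (hs : ∑ i, x i + ∑ k, y k = 0) :
    ∑ i, ∑ k, (inner ℝ (x i) (v k - u i) / K - inner ℝ (y k) (v k - u i) / n
      - inner ℝ (∑ j, x j) (v k - u i) / (n * K))
      = - (∑ i, inner ℝ (x i) (u i) + ∑ k, inner ℝ (y k) (v k)) := by
  have hn' : (n : ℝ) ≠ 0 := (Nat.cast_pos.2 hn).ne'
  have hK' : (K : ℝ) ≠ 0 := (Nat.cast_pos.2 hK).ne'
  have hX : ∑ i, x i = - ∑ k, y k := eq_neg_of_add_eq_zero_left hs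
  have e1 : ∑ i, ∑ k, inner ℝ (x i) (v k - u i)
      = inner ℝ (∑ i, x i) (∑ k, v k) - K * ∑ i, inner ℝ (x i) (u i) := by
    rw [sum_inner]
    simp only [inner_sum, inner_sub_right, Finset.sum_sub_distrib, Finset.sum_const,
      Finset.card_univ, Fintype.card_fin, nsmul_eq_mul, Finset.mul_sum]
  have e2 : ∑ i, ∑ k, inner ℝ (y k) (v k - u i)
      = n * (∑ k, inner ℝ (y k) (v k)) + inner ℝ (∑ i, x i) (∑ i, u i) := by
    rw [hX, inner_neg_left, inner_sum]
    simp only [sum_inner, inner_sub_right, Finset.sum_sub_distrib, Finset.sum_const,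
      Finset.card_univ, Fintype.card_fin, nsmul_eq_mul, ← sub_eq_add_neg]
  have e3 : ∑ i, ∑ k, inner ℝ (∑ j, x j) (v k - u i)
      = n * inner ℝ (∑ i, x i) (∑ k, v k) - K * inner ℝ (∑ i, x i) (∑ i, u i) := by
    generalize ∑ i, x i = X
    simp only [inner_sum, inner_sub_right, Finset.sum_sub_distrib, Finset.sum_const,
      Finset.card_univ, Fintype.card_fin, nsmul_eq_mul, Finset.mul_sum]
  simp only [Finset.sum_sub_distrib, ← Finset.sum_div]
  rw [e1, e2, e3]
  field_simp
  ring

lemma sum_flowSlope (hn : 0 < n) (hK : 0 < K) (μ : ℝ) (f : Fin n → Vec d → ℝ) (θs : Vec d)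
    (s : State d n K)
    (hs : ∑ i, nodeFlow μ f θs s i + ∑ k, tokenFlow μ θs s k = 0) :
    ∑ i, ∑ k, flowSlope μ f θs s i k = - (μ * sqDist θs s
      + ∑ i, inner ℝ (gradient (f i) (s.virt i) - gradient (f i) θs) (s.node i - θs)) := by
  have h := sum_edges_inner hn hK (nodeFlow μ f θs s) (fun i => s.node i - θs)
    (tokenFlow μ θs s) (fun k => s.token k - θs) hs
  simp only [sub_sub_sub_cancel_right] at h
  unfold flowSlope
  rw [h]
  simp only [nodeFlow, tokenFlow, sqDist, inner_add_left, inner_smul_left,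
    real_inner_self_eq_norm_sq, conj_trivial, Finset.sum_add_distrib, ← Finset.mul_sum]
  ring

end Lyapunov

section CompStep

variable {d n K : ℕ}

/-! ### Effect of a computation step -/

lemma nodeFlow_compStep {σ : ℝ} (hμ : sigmaTilde n K σ ≠ 0) (f : Fin n → Vec d → ℝ) (θs : Vec d)
    (ρ : ℝ) (i : Fin n) (s : State d n K) :
    nodeFlow (sigmaTilde n K σ) f θs (compStep σ ρ f i s)
      = nodeFlow (sigmaTilde n K σ) f θs s := by
  ext1 j
  by_cases hj : j = i
  · subst hj
    simp only [nodeFlow, compStep, Function.update_self, smul_sub, smul_inv_smul₀ hμ]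
    abel
  · simp only [nodeFlow, compStep, Function.update_of_ne hj]

lemma flowEnergy_compStep {σ : ℝ} (hμ : sigmaTilde n K σ ≠ 0) (f : Fin n → Vec d → ℝ)
    (θs : Vec d) (ρ : ℝ) (i : Fin n) (s : State d n K) :
    flowEnergy (sigmaTilde n K σ) f θs (compStep σ ρ f i s)
      = flowEnergy (sigmaTilde n K σ) f θs s := by
  unfold flowEnergy
  rw [nodeFlow_compStep hμ]
  rfl

lemma newVirt_sub (ρ : ℝ) (i : Fin n) (s : State d n K) :
    newVirt ρ i s - s.virt i = ρ • (s.node i - s.virt i) := by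
  unfold newVirt
  module

lemma virtGap_compStep (σ : ℝ) (f : Fin n → Vec d → ℝ) (θs : Vec d) (ρ : ℝ) (i : Fin n)
    (s : State d n K) :
    virtGap f θs (compStep σ ρ f i s) = virtGap f θs s
      + ρ * (inner ℝ (gradient (f i) (s.virt i) - gradient (f i) θs) (s.node i - θs)
        - (bregman (f i) (s.virt i) θs + bregman (f i) θs (s.virt i)))
      + bregman (f i) (newVirt ρ i s) (s.virt i) := by
  unfold virtGap
  simp only [compStep]
  rw [sum_comp_update (fun j w => bregman (f j) w θs),
    bregman_three_point (f i) (newVirt ρ i s) (s.virt i) θs, newVirt_sub, bregman_add_swap,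
    inner_smul_right, ← inner_sub_right, sub_sub_sub_cancel_right]
  ring

/-- A computation step decreases the dual gap, by at least the divergence that it adds to
`virtGap`, up to the factor `ρ`. -/
lemma dualGap_compStep_le {σ L ρ : ℝ} (hμ : 0 < sigmaTilde n K σ) (hL : 0 < L)
    {f : Fin n → Vec d → ℝ} (hconv : ∀ i, ConvexOn ℝ Set.univ (f i))
    (hsmooth : ∀ i, LSmooth L (f i)) (hρ : 0 < ρ) (hρ1 : ρ * (1 + L / sigmaTilde n K σ) ≤ 1)
    (θs : Vec d) (i : Fin n) (s : State d n K) :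
    ρ * (dualGap (sigmaTilde n K σ) f θs (compStep σ ρ f i s)
        - dualGap (sigmaTilde n K σ) f θs s)
      ≤ - bregman (f i) (newVirt ρ i s) (s.virt i) := by
  set μ := sigmaTilde n K σ with hμdef
  set z' := newVirt ρ i s with hz'
  set Δ := gradient (f i) z' - gradient (f i) (s.virt i) with hΔ
  have hnode : sqDist θs (compStep σ ρ f i s) = sqDist θs s
      - 2 * μ⁻¹ * inner ℝ Δ (s.node i - θs) + μ⁻¹ ^ 2 * ‖Δ‖ ^ 2 := by
    unfold sqDist
    simp only [compStep, ← hμdef, ← hz', ← hΔ]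
    rw [sum_comp_update (fun _ w => ‖w - θs‖ ^ 2), sub_right_comm, norm_sub_sq_real,
      inner_smul_right, real_inner_comm, norm_smul, mul_pow, Real.norm_eq_abs, sq_abs]
    ring
  have hvirt : virtGapSwap f θs (compStep σ ρ f i s) = virtGapSwap f θs s
      + inner ℝ Δ (s.virt i - θs) + bregman (f i) (s.virt i) z' := by
    unfold virtGapSwap
    simp only [compStep, ← hz']
    rw [sum_comp_update (fun j w => bregman (f j) θs w),
      bregman_three_point (f i) θs (s.virt i) z', ← neg_sub (gradient (f i) z'), ← hΔ,
      ← neg_sub (s.virt i) θs, inner_neg_neg]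
    ring
  have hsum : bregman (f i) z' (s.virt i) + bregman (f i) (s.virt i) z'
      = ρ * (inner ℝ Δ (s.node i - θs) - inner ℝ Δ (s.virt i - θs)) := by
    rw [bregman_add_swap, ← hΔ, hz', newVirt_sub, inner_smul_right, ← inner_sub_right,
      sub_sub_sub_cancel_right]
  have hco : ‖Δ‖ ^ 2 ≤ 2 * L * bregman (f i) (s.virt i) z' :=
    norm_gradient_sub_sq_le_swap hL (hconv i) (hsmooth i).1 (hsmooth i).2 _ _
  have hD := bregman_nonneg (hconv i) (hsmooth i).1 (s.virt i) z'
  have key : ρ * (dualGap μ f θs (compStep σ ρ f i s) - dualGap μ f θs s)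
      = - (bregman (f i) z' (s.virt i) + bregman (f i) (s.virt i) z')
        + ρ * (bregman (f i) (s.virt i) z' + μ⁻¹ / 2 * ‖Δ‖ ^ 2) := by
    rw [hsum]
    unfold dualGap
    rw [hnode, hvirt]
    field_simp
    ring
  have h1 : μ⁻¹ / 2 * ‖Δ‖ ^ 2 ≤ L / μ * bregman (f i) (s.virt i) z' := by
    calc μ⁻¹ / 2 * ‖Δ‖ ^ 2 ≤ μ⁻¹ / 2 * (2 * L * bregman (f i) (s.virt i) z') := by gcongr
      _ = L / μ * bregman (f i) (s.virt i) z' := by ring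
  have h2 : ρ * (bregman (f i) (s.virt i) z' + μ⁻¹ / 2 * ‖Δ‖ ^ 2)
      ≤ bregman (f i) (s.virt i) z' := by
    calc _ ≤ ρ * (bregman (f i) (s.virt i) z' + L / μ * bregman (f i) (s.virt i) z') := by gcongr
      _ = ρ * (1 + L / μ) * bregman (f i) (s.virt i) z' := by ring
      _ ≤ 1 * bregman (f i) (s.virt i) z' := by gcongr
      _ = _ := one_mul _
  rw [key]
  linarith

/-! ### One-step contraction -/

lemma lyapunov_commStep_le (hn : 0 < n) (hK : 0 < K) (hKn : K ≤ n) {μ α η ρ : ℝ}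
    (hη : 0 < η) (hρ : ρ ≤ 1 / 2) (hρη : ρ * μ = 2 * n * K * η) (f : Fin n → Vec d → ℝ)
    (θs : Vec d) (i : Fin n) (k : Fin K) (s : State d n K) :
    lyapunov μ α η f θs (commStep ρ i k s)
      ≤ lyapunov μ α η f θs s + 2 * n * K * η * flowSlope μ f θs s i k := by
  have hn' : (0 : ℝ) < n := Nat.cast_pos.2 hn
  have hK' : (0 : ℝ) < K := Nat.cast_pos.2 hK
  have hKn' : (K : ℝ) ≤ n := Nat.cast_le.2 hKn
  unfold lyapunov dualGap
  rw [flowEnergy_commStep, sqDist_commStep, hρη]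
  have hA : virtGap f θs (commStep ρ i k s) = virtGap f θs s := rfl
  have hB : virtGapSwap f θs (commStep ρ i k s) = virtGapSwap f θs s := rfl
  rw [hA, hB]
  set D := ‖s.token k - s.node i‖ ^ 2 with hDdef
  have hD : 0 ≤ D := sq_nonneg _
  have e1 : (2 * n * K * η) ^ 2 * (1 / K + 1 / n - 1 / (n * K)) * D
      = 4 * n * K * η ^ 2 * (n + K - 1) * D := by
    field_simp
    ring
  have e2 : 4 * η * n * (μ / 2 * (sqDist θs s - 2 * ρ * (1 - ρ) * D) + virtGapSwap f θs s)
      = 4 * η * n * (μ / 2 * sqDist θs s + virtGapSwap f θs s)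
        - 4 * η * n * (1 - ρ) * (ρ * μ) * D := by ring
  rw [e1, e2, hρη]
  have h3 : 4 * n * K * η ^ 2 * (n + K - 1) * D ≤ 4 * n * K * η ^ 2 * (2 * n) * D := by
    gcongr
    linarith
  have h4 : 4 * η * n * (1 / 2) * (2 * n * K * η) * D
      ≤ 4 * η * n * (1 - ρ) * (2 * n * K * η) * D := by
    gcongr
    linarith
  linarith

lemma lyapunov_compStep_le (hn : 0 < n) {σ L α η ρ : ℝ} (hμ : 0 < sigmaTilde n K σ) (hL : 0 < L)
    {f : Fin n → Vec d → ℝ} (hconv : ∀ i, ConvexOn ℝ Set.univ (f i))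
    (hsmooth : ∀ i, LSmooth L (f i)) (hα : 0 < α) (hη : 0 < η) (hρη : ρ = 2 * n * α * η)
    (hρ1 : ρ * (1 + L / sigmaTilde n K σ) ≤ 1) (θs : Vec d) (i : Fin n) (s : State d n K) :
    lyapunov (sigmaTilde n K σ) α η f θs (compStep σ ρ f i s)
      ≤ lyapunov (sigmaTilde n K σ) α η f θs s
        + 2 * n * η * (inner ℝ (gradient (f i) (s.virt i) - gradient (f i) θs) (s.node i - θs)
        - (bregman (f i) (s.virt i) θs + bregman (f i) θs (s.virt i))) := by
  have hn' : (0 : ℝ) < n := Nat.cast_pos.2 hn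
  have hρ : 0 < ρ := by rw [hρη]; positivity
  have hdual := dualGap_compStep_le hμ hL hconv hsmooth hρ hρ1 θs i s
  have hD := bregman_nonneg (hconv i) (hsmooth i).1 (newVirt ρ i s) (s.virt i)
  unfold lyapunov
  rw [flowEnergy_compStep hμ.ne', virtGap_compStep]
  set D := bregman (f i) (newVirt ρ i s) (s.virt i)
  set G := inner ℝ (gradient (f i) (s.virt i) - gradient (f i) θs) (s.node i - θs)
        - (bregman (f i) (s.virt i) θs + bregman (f i) θs (s.virt i))
  set E' := dualGap (sigmaTilde n K σ) f θs (compStep σ ρ f i s)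
  set E := dualGap (sigmaTilde n K σ) f θs s
  have e1 : (virtGap f θs s + ρ * G + D) / α = virtGap f θs s / α + 2 * n * η * G + D / α := by
    rw [hρη]
    field_simp
  have e2 : 4 * η * n * (E' - E) = 2 / α * (ρ * (E' - E)) := by
    rw [hρη]
    field_simp
    ring
  have h3 : 2 / α * (ρ * (E' - E)) ≤ 2 / α * (-D) := by gcongr
  have h4 : 2 / α * (-D) + D / α = - (D / α) := by ring
  have h5 : 0 ≤ D / α := by positivity
  rw [e1]
  linarith

/-- The expectation of the Lyapunov function after one step of the algorithm decreases; the
inner products of the two kinds of steps cancel. -/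
lemma lyapunov_mean_le (hn : 0 < n) (hK : 0 < K) (hKn : K ≤ n) {σ L α η ρ ρ' : ℝ}
    (hμ : 0 < sigmaTilde n K σ) (hL : 0 < L)
    {f : Fin n → Vec d → ℝ} (hconv : ∀ i, ConvexOn ℝ Set.univ (f i))
    (hsmooth : ∀ i, LSmooth L (f i)) (hα : 0 < α) (hη : 0 < η)
    (hρ : ρ ≤ 1 / 2) (hρη : ρ * sigmaTilde n K σ = 2 * n * K * η)
    (hρη' : ρ' = 2 * n * α * η) (hρ1 : ρ' * (1 + L / sigmaTilde n K σ) ≤ 1)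
    (θs : Vec d) (s : State d n K)
    (hs : ∑ i, nodeFlow (sigmaTilde n K σ) f θs s i
      + ∑ k, tokenFlow (sigmaTilde n K σ) θs s k = 0) :
    1 / 2 / (n * K) * (∑ i, ∑ k, lyapunov (sigmaTilde n K σ) α η f θs (commStep ρ i k s))
      + 1 / 2 / n * (∑ i, lyapunov (sigmaTilde n K σ) α η f θs (compStep σ ρ' f i s))
      ≤ lyapunov (sigmaTilde n K σ) α η f θs s
        - η * (sigmaTilde n K σ * sqDist θs s + virtGap f θs s + virtGapSwap f θs s) := by
  have hn' : (0 : ℝ) < n := Nat.cast_pos.2 hn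
  have hK' : (0 : ℝ) < K := Nat.cast_pos.2 hK
  set μ := sigmaTilde n K σ with hμdef
  set Φ := lyapunov μ α η f θs s with hΦ
  have h1 : ∑ i, ∑ k, lyapunov μ α η f θs (commStep ρ i k s)
      ≤ n * K * Φ + 2 * n * K * η * ∑ i, ∑ k, flowSlope μ f θs s i k := by
    calc _ ≤ ∑ i, ∑ k, (Φ + 2 * n * K * η * flowSlope μ f θs s i k) :=
          Finset.sum_le_sum fun i _ => Finset.sum_le_sum fun k _ =>
            lyapunov_commStep_le hn hK hKn hη hρ hρη f θs i k s
      _ = _ := by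
          simp only [Finset.sum_add_distrib, Finset.sum_const, Finset.card_univ,
            Fintype.card_fin, nsmul_eq_mul, Finset.mul_sum]
          ring
  have h2 : ∑ i, lyapunov μ α η f θs (compStep σ ρ' f i s)
      ≤ n * Φ + 2 * n * η * (∑ i, inner ℝ (gradient (f i) (s.virt i) - gradient (f i) θs)
          (s.node i - θs) - (virtGap f θs s + virtGapSwap f θs s)) := by
    calc _ ≤ ∑ i, (Φ + 2 * n * η * (inner ℝ (gradient (f i) (s.virt i) - gradient (f i) θs)
            (s.node i - θs) - (bregman (f i) (s.virt i) θs + bregman (f i) θs (s.virt i)))) :=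
          Finset.sum_le_sum fun i _ =>
            lyapunov_compStep_le hn hμ hL hconv hsmooth hα hη hρη' hρ1 θs i s
      _ = _ := by
          unfold virtGap virtGapSwap
          simp only [Finset.sum_add_distrib, Finset.sum_sub_distrib, Finset.sum_const,
            Finset.card_univ, Fintype.card_fin, nsmul_eq_mul, ← Finset.mul_sum]
  rw [sum_flowSlope hn hK μ f θs s hs] at h1
  have h3 := mul_le_mul_of_nonneg_left h1 (show (0 : ℝ) ≤ 1 / 2 / (n * K) by positivity)
  have h4 := mul_le_mul_of_nonneg_left h2 (show (0 : ℝ) ≤ 1 / 2 / n by positivity)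
  refine (add_le_add h3 h4).trans (le_of_eq ?_)
  field_simp
  ring

lemma sqDist_nonneg (θs : Vec d) (s : State d n K) : 0 ≤ sqDist θs s := by
  unfold sqDist
  positivity

lemma virtGap_nonneg {L : ℝ} {f : Fin n → Vec d → ℝ} (hconv : ∀ i, ConvexOn ℝ Set.univ (f i))
    (hsmooth : ∀ i, LSmooth L (f i)) (θs : Vec d) (s : State d n K) : 0 ≤ virtGap f θs s :=
  Finset.sum_nonneg fun i _ => bregman_nonneg (hconv i) (hsmooth i).1 _ _

lemma virtGapSwap_nonneg {L : ℝ} {f : Fin n → Vec d → ℝ}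
    (hconv : ∀ i, ConvexOn ℝ Set.univ (f i)) (hsmooth : ∀ i, LSmooth L (f i)) (θs : Vec d)
    (s : State d n K) : 0 ≤ virtGapSwap f θs s :=
  Finset.sum_nonneg fun i _ => bregman_nonneg (hconv i) (hsmooth i).1 _ _

lemma dualGap_nonneg {μ L : ℝ} (hμ : 0 ≤ μ) {f : Fin n → Vec d → ℝ}
    (hconv : ∀ i, ConvexOn ℝ Set.univ (f i)) (hsmooth : ∀ i, LSmooth L (f i)) (θs : Vec d)
    (s : State d n K) : 0 ≤ dualGap μ f θs s := by
  have hS := sqDist_nonneg θs s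
  have hB := virtGapSwap_nonneg hconv hsmooth θs s
  unfold dualGap
  positivity

/-- The Lyapunov function is dominated by the quantity that controls its decrease. -/
lemma lyapunov_le (hn : 0 < n) (hK : 0 < K) (hKn : K ≤ n) {μ L α η : ℝ} (hμ : 0 < μ) (hL : 0 < L)
    {f : Fin n → Vec d → ℝ} (hconv : ∀ i, ConvexOn ℝ Set.univ (f i))
    (hsmooth : ∀ i, LSmooth L (f i)) (hαL : 1 / α ≤ (L + μ) / (2 * K))
    (hημ : 4 * n * η ≤ μ / K) (θs : Vec d) (s : State d n K) :
    lyapunov μ α η f θs s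
      ≤ 3 * (L + μ) / K * (μ * sqDist θs s + virtGap f θs s + virtGapSwap f θs s) := by
  have hn' : (0 : ℝ) < n := Nat.cast_pos.2 hn
  have hK' : (0 : ℝ) < K := Nat.cast_pos.2 hK
  have hKn' : (K : ℝ) ≤ n := Nat.cast_le.2 hKn
  have hS := sqDist_nonneg θs s
  have hA := virtGap_nonneg hconv hsmooth θs s
  have hB := virtGapSwap_nonneg hconv hsmooth θs s
  have hnode : ∑ i, ‖nodeFlow μ f θs s i‖ ^ 2
      ≤ 2 * μ ^ 2 * ∑ i, ‖s.node i - θs‖ ^ 2 + 2 * L * (virtGap f θs s + virtGapSwap f θs s) := by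
    unfold virtGap virtGapSwap
    rw [← Finset.sum_add_distrib, Finset.mul_sum, Finset.mul_sum, ← Finset.sum_add_distrib]
    refine Finset.sum_le_sum fun i _ => ?_
    have h1 := norm_gradient_sub_sq_le hL (hconv i) (hsmooth i).1 (hsmooth i).2 (s.virt i) θs
    have h2 := norm_gradient_sub_sq_le_swap hL (hconv i) (hsmooth i).1 (hsmooth i).2 (s.virt i) θs
    have h3 : ‖nodeFlow μ f θs s i‖ ^ 2 ≤ 2 * (‖μ • (s.node i - θs)‖ ^ 2
        + ‖gradient (f i) (s.virt i) - gradient (f i) θs‖ ^ 2) :=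
      (pow_le_pow_left₀ (norm_nonneg _) (norm_add_le _ _) 2).trans add_sq_le
    rw [norm_smul, mul_pow, Real.norm_eq_abs, sq_abs] at h3
    linarith
  have htok : ∑ k, ‖tokenFlow μ θs s k‖ ^ 2 = μ ^ 2 * ∑ k, ‖s.token k - θs‖ ^ 2 := by
    simp only [tokenFlow, norm_smul, mul_pow, Real.norm_eq_abs, sq_abs, Finset.mul_sum]
  have htok0 : 0 ≤ μ ^ 2 * ∑ k, ‖s.token k - θs‖ ^ 2 := by positivity
  have hQ : flowEnergy μ f θs s
      ≤ 2 * (μ ^ 2 * sqDist θs s + L * (virtGap f θs s + virtGapSwap f θs s)) / K := by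
    refine (flowEnergy_le μ f θs s).trans ?_
    rw [htok]
    have h1 : (μ ^ 2 * ∑ k, ‖s.token k - θs‖ ^ 2) / (n : ℝ)
        ≤ (μ ^ 2 * ∑ k, ‖s.token k - θs‖ ^ 2) / K := by gcongr
    have h2 : (∑ i, ‖nodeFlow μ f θs s i‖ ^ 2) / (K : ℝ)
        ≤ (2 * μ ^ 2 * ∑ i, ‖s.node i - θs‖ ^ 2
          + 2 * L * (virtGap f θs s + virtGapSwap f θs s)) / K := by gcongr
    refine (add_le_add h2 h1).trans ?_
    rw [← add_div]
    gcongr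
    unfold sqDist
    linarith
  have hAα : virtGap f θs s / α ≤ (L + μ) / (2 * K) * virtGap f θs s := by
    rw [div_eq_mul_one_div, mul_comm]
    gcongr
  have hE : 4 * η * n * dualGap μ f θs s
      ≤ μ / K * (μ / 2 * sqDist θs s + virtGapSwap f θs s) := by
    unfold dualGap
    have : 4 * η * n ≤ μ / K := by linarith
    gcongr
  unfold lyapunov
  generalize sqDist θs s = S at *
  generalize virtGap f θs s = A at *
  generalize virtGapSwap f θs s = B at *
  have h : flowEnergy μ f θs s / 2 + A / α + 4 * η * n * dualGap μ f θs s
      ≤ ((μ ^ 2 * S + L * (A + B)) + (L + μ) / 2 * A + μ * (μ / 2 * S + B)) / K := by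
    have e : ((μ ^ 2 * S + L * (A + B)) + (L + μ) / 2 * A + μ * (μ / 2 * S + B)) / K
      = 2 * (μ ^ 2 * S + L * (A + B)) / K / 2 + (L + μ) / (2 * K) * A
        + μ / K * (μ / 2 * S + B) := by
      field_simp
    rw [e]
    gcongr
  refine h.trans ?_
  rw [div_mul_eq_mul_div (3 * (L + μ))]
  refine div_le_div_of_nonneg_right ?_ hK'.le
  have p1 : 0 ≤ μ * A := by positivity
  have p2 : 0 ≤ μ * B := by positivity
  have p3 : 0 ≤ L * A := by positivity
  have p4 : 0 ≤ L * B := by positivity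
  have p5 : 0 ≤ L * (μ * S) := by positivity
  have p6 : 0 ≤ μ * (μ * S) := by positivity
  nlinarith

end CompStep

/-! ### Expectations along the random iterates -/

section Sampling

variable {d n K : ℕ}

instance : DiscreteMeasurableSpace (Action n K) := ⟨fun _ => trivial⟩

instance : Finite (Action n K) := by
  refine Finite.of_surjective
    (fun x : (Fin n × Fin K) ⊕ Fin n =>
      Sum.elim (fun p => Action.comm p.1 p.2) (fun i => Action.comp i) x) ?_
  rintro (⟨i, k⟩ | i)
  · exact ⟨Sum.inl (i, k), rfl⟩
  · exact ⟨Sum.inr i, rfl⟩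

lemma iterate_congr (σ L α pcomm pcomp : ℝ) (f : Fin n → Vec d → ℝ) (z₀ : Fin n → Vec d)
    {a b : ℕ → Action n K} {t : ℕ} (h : ∀ s < t, a s = b s) :
    iterate σ L α pcomm pcomp f z₀ a t = iterate σ L α pcomm pcomp f z₀ b t := by
  induction t with
  | zero => rfl
  | succ t ih =>
    simp only [iterate]
    rw [ih fun s hs => h s (hs.trans t.lt_succ_self), h t t.lt_succ_self]

/-- The state at time `t` is a function of the actions before time `t`. -/
lemma exists_iterate_eq (hn : 0 < n) (σ L α pcomm pcomp : ℝ) (f : Fin n → Vec d → ℝ)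
    (z₀ : Fin n → Vec d) (t : ℕ) :
    ∃ G : (Finset.range t → Action n K) → State d n K, ∀ a : ℕ → Action n K,
      iterate σ L α pcomm pcomp f z₀ a t = G fun s => a s := by
  refine ⟨fun h => iterate σ L α pcomm pcomp f z₀
    (fun s => if hs : s ∈ Finset.range t then h ⟨s, hs⟩ else Action.comp ⟨0, hn⟩) t, fun a => ?_⟩
  refine iterate_congr σ L α pcomm pcomp f z₀ fun s hs => ?_
  rw [dif_pos (Finset.mem_range.2 hs)]

variable {Ω : Type*} [MeasurableSpace Ω] {P : Measure Ω}
  {pcomm pcomp : ℝ} {a : ℕ → Ω → Action n K}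

lemma IsSampling.measurableSet (ha : IsSampling P pcomm pcomp a) (p : Action n K → Prop)
    (t : ℕ) : MeasurableSet {ω | p (a t ω)} :=
  ha.measurable t (MeasurableSet.of_discrete (s := {b | p b}))

/-- Only finitely many states can be reached in `t` steps, so every function of the state is
integrable. -/
lemma integrable_iterate [IsProbabilityMeasure P] (hn : 0 < n)
    (ha : IsSampling P pcomm pcomp a) (σ L α : ℝ)
    (f : Fin n → Vec d → ℝ) (z₀ : Fin n → Vec d) (t : ℕ) (F : State d n K → ℝ) :
    Integrable (fun ω => F (iterate σ L α pcomm pcomp f z₀ (fun s => a s ω) t)) P := by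
  obtain ⟨G, hG⟩ := exists_iterate_eq (K := K) hn σ L α pcomm pcomp f z₀ t
  simp only [hG]
  have hm : Measurable fun ω (s : Finset.range t) => a s ω :=
    measurable_pi_lambda _ fun s => ha.measurable s
  exact (Integrable.of_finite (μ := P.map fun ω (s : Finset.range t) => a s ω)
    (f := fun h => F (G h))).comp_measurable hm

lemma integral_indicator_mul_iterate (hn : 0 < n) (ha : IsSampling P pcomm pcomp a) (σ L α : ℝ)
    (f : Fin n → Vec d → ℝ) (z₀ : Fin n → Vec d) (t : ℕ) (F : State d n K → ℝ)
    (b : Action n K) :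
    ∫ ω, {ω | a t ω = b}.indicator 1 ω
        * F (iterate σ L α pcomm pcomp f z₀ (fun s => a s ω) t) ∂P
      = P.real {ω | a t ω = b}
        * ∫ ω, F (iterate σ L α pcomm pcomp f z₀ (fun s => a s ω) t) ∂P := by
  obtain ⟨G, hG⟩ := exists_iterate_eq (K := K) hn σ L α pcomm pcomp f z₀ t
  simp only [hG]
  have hind := ha.indep.indepFun_finset {t} (Finset.range t) (by simp) ha.measurable
  have hb : MeasurableSet {ω | a t ω = b} := ha.measurableSet (· = b) t
  have hind' : IndepFun (fun ω => {ω | a t ω = b}.indicator (1 : Ω → ℝ) ω)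
      (fun ω => F (G fun s => a s ω)) P := by
    refine hind.comp (φ := fun h => ({b} : Set (Action n K)).indicator (1 : Action n K → ℝ)
      (h ⟨t, Finset.mem_singleton_self t⟩)) (ψ := fun h => F (G h)) ?_ ?_
    · exact Measurable.of_discrete
    · exact Measurable.of_discrete
  have hm : Measurable fun ω (s : Finset.range t) => a s ω :=
    measurable_pi_lambda _ fun s => ha.measurable s
  rw [hind'.integral_fun_mul_eq_mul_integral, integral_indicator_one hb]
  · exact (measurable_one.indicator hb).aestronglyMeasurable
  · exact ((Measurable.of_discrete (f := fun h => F (G h))).comp hm).aestronglyMeasurable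

/-- Conditioning on the past: the action at time `t` is independent of the state at time `t`. -/
lemma integral_iterate_succ [IsProbabilityMeasure P] (hn : 0 < n)
    (ha : IsSampling P pcomm pcomp a) (σ L α : ℝ)
    (f : Fin n → Vec d → ℝ) (z₀ : Fin n → Vec d) (t : ℕ) (F : State d n K → ℝ) :
    ∫ ω, F (iterate σ L α pcomm pcomp f z₀ (fun s => a s ω) (t + 1)) ∂P
      = ∫ ω, (pcomm / (n * K) * (∑ i, ∑ k, F (commStep (rhoComm n K σ L α pcomm pcomp) i k
            (iterate σ L α pcomm pcomp f z₀ (fun s => a s ω) t)))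
        + pcomp / n * ∑ i, F (compStep σ (rhoComp n K σ L α pcomm pcomp) f i
            (iterate σ L α pcomm pcomp f z₀ (fun s => a s ω) t))) ∂P := by
  set s : Ω → State d n K := fun ω => iterate σ L α pcomm pcomp f z₀ (fun s => a s ω) t
  have hint : ∀ H : State d n K → ℝ, Integrable (fun ω => H (s ω)) P :=
    integrable_iterate hn ha σ L α f z₀ t
  have hintI : ∀ (b : Action n K) (H : State d n K → ℝ),
      Integrable (fun ω => {ω | a t ω = b}.indicator 1 ω * H (s ω)) P := by
    classical
    intro b H
    have hb : MeasurableSet {ω | a t ω = b} := ha.measurableSet (· = b) t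
    refine ((hint H).indicator hb).congr (ae_of_all _ fun ω => ?_)
    simp [Set.indicator_apply]
  have hstep : ∀ ω, F (iterate σ L α pcomm pcomp f z₀ (fun s => a s ω) (t + 1))
      = ∑ i, ∑ k, {ω | a t ω = Action.comm i k}.indicator 1 ω
          * F (commStep (rhoComm n K σ L α pcomm pcomp) i k (s ω))
        + ∑ i, {ω | a t ω = Action.comp i}.indicator 1 ω
          * F (compStep σ (rhoComp n K σ L α pcomm pcomp) f i (s ω)) := by
    classical
    intro ω
    simp only [iterate, Set.indicator_apply, Set.mem_ofPred_eq, Pi.one_apply]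
    change F (step σ L α pcomm pcomp f (a t ω) (s ω)) = _
    cases h : a t ω with
    | comm i k =>
      simp [step, ite_and]
    | comp i => simp [step]
  simp only [hstep]
  have hcomm : ∀ i k, ∫ ω, {ω | a t ω = Action.comm i k}.indicator 1 ω
      * F (commStep (rhoComm n K σ L α pcomm pcomp) i k (s ω)) ∂P
      = pcomm / (n * K) * ∫ ω, F (commStep (rhoComm n K σ L α pcomm pcomp) i k (s ω)) ∂P :=
    fun i k => by
      rw [← ha.comm_prob t i k]
      exact integral_indicator_mul_iterate hn ha σ L α f z₀ t
        (fun x => F (commStep (rhoComm n K σ L α pcomm pcomp) i k x)) _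
  have hcomp : ∀ i, ∫ ω, {ω | a t ω = Action.comp i}.indicator 1 ω
      * F (compStep σ (rhoComp n K σ L α pcomm pcomp) f i (s ω)) ∂P
      = pcomp / n * ∫ ω, F (compStep σ (rhoComp n K σ L α pcomm pcomp) f i (s ω)) ∂P :=
    fun i => by
      rw [← ha.comp_prob t i]
      exact integral_indicator_mul_iterate hn ha σ L α f z₀ t
        (fun x => F (compStep σ (rhoComp n K σ L α pcomm pcomp) f i x)) _
  rw [integral_add, integral_add, integral_const_mul, integral_const_mul, integral_finsetSum,
    integral_finsetSum, integral_finsetSum, integral_finsetSum]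
  · congr 1
    · rw [Finset.mul_sum]
      refine Finset.sum_congr rfl fun i _ => ?_
      rw [integral_finsetSum, integral_finsetSum, Finset.mul_sum]
      · exact Finset.sum_congr rfl fun k _ => hcomm i k
      · exact fun k _ => hint fun x => F (commStep _ i k x)
      · exact fun k _ => hintI _ fun x => F (commStep _ i k x)
    · rw [Finset.mul_sum]
      exact Finset.sum_congr rfl fun i _ => hcomp i
  · exact fun i _ => hint fun x => F (compStep _ _ f i x)
  · exact fun i _ => hint fun x => ∑ k, F (commStep _ i k x)
  · exact fun i _ => hintI _ fun x => F (compStep _ _ f i x)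
  · exact fun i _ => integrable_finsetSum _ fun k _ => hintI _ fun x => F (commStep _ i k x)
  · exact hint fun x => _ * ∑ i, ∑ k, F (commStep _ i k x)
  · exact hint fun x => _ * ∑ i, F (compStep _ _ f i x)
  · exact integrable_finsetSum _ fun i _ => integrable_finsetSum _ fun k _ =>
      hintI _ fun x => F (commStep _ i k x)
  · exact integrable_finsetSum _ fun i _ => hintI _ fun x => F (compStep _ _ f i x)

/-! ### Expected numbers of steps -/

open Classical in
lemma integral_card_filter [IsProbabilityMeasure P] {β : Type*} {a : ℕ → Ω → β} (p : β → Prop)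
    (hp : ∀ t, MeasurableSet {ω | p (a t ω)}) (T : ℕ) :
    ∫ ω, (((Finset.range T).filter fun t => p (a t ω)).card : ℝ) ∂P
      = ∑ t ∈ Finset.range T, P.real {ω | p (a t ω)} := by
  have h : ∀ ω, (((Finset.range T).filter fun t => p (a t ω)).card : ℝ)
      = ∑ t ∈ Finset.range T, {ω | p (a t ω)}.indicator 1 ω := by
    intro ω
    simp [Set.indicator_apply, Finset.sum_boole]
  simp only [h]
  rw [integral_finsetSum]
  · exact Finset.sum_congr rfl fun t _ => integral_indicator_one (hp t)
  · exact fun t _ => (integrable_const (1 : ℝ)).indicator (hp t)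

lemma integral_gradSteps [IsProbabilityMeasure P]
    (ha : IsSampling P pcomm pcomp a) (i : Fin n) (T : ℕ) :
    ∫ ω, (gradSteps (fun s => a s ω) i T : ℝ) ∂P = T * (pcomp / n) := by
  have h := integral_card_filter (P := P) (a := a) (· = Action.comp i)
    (fun t => ha.measurableSet (· = Action.comp i) t) T
  simp only [ha.comp_prob, Finset.sum_const, Finset.card_range, nsmul_eq_mul] at h
  exact h

lemma prob_jump [IsProbabilityMeasure P]
    (ha : IsSampling P pcomm pcomp a) (hn : 0 < n) (k : Fin K) (t : ℕ) :
    P.real {ω | ∃ i, a t ω = Action.comm i k} = pcomm / K := by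
  have hU : {ω | ∃ i, a t ω = Action.comm i k} = ⋃ i, {ω | a t ω = Action.comm i k} := by
    ext ω
    simp
  rw [hU, measureReal_iUnion_fintype]
  · simp only [ha.comm_prob, Finset.sum_const, Finset.card_univ, Fintype.card_fin, nsmul_eq_mul]
    have : (n : ℝ) ≠ 0 := (Nat.cast_pos.2 hn).ne'
    field_simp
  · intro i j hij
    refine Set.disjoint_left.2 fun ω h1 h2 => hij ?_
    have := h1.symm.trans h2
    exact (Action.comm.inj this).1
  · exact fun i => ha.measurableSet (· = Action.comm i k) t

lemma integral_tokenJumps [IsProbabilityMeasure P]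
    (ha : IsSampling P pcomm pcomp a) (hn : 0 < n) (k : Fin K) (T : ℕ) :
    ∫ ω, (tokenJumps (fun s => a s ω) k T : ℝ) ∂P = T * (pcomm / K) := by
  have h := integral_card_filter (P := P) (a := a) (fun b => ∃ i, b = Action.comm i k)
    (fun t => ha.measurableSet (fun b => ∃ i, b = Action.comm i k) t) T
  simp only [prob_jump ha hn, Finset.sum_const, Finset.card_range, nsmul_eq_mul] at h
  rw [← h]
  unfold tokenJumps
  congr!

lemma prob_comm [IsProbabilityMeasure P]
    (ha : IsSampling P pcomm pcomp a) (hn : 0 < n) (hK : 0 < K) (t : ℕ) :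
    P.real {ω | ∃ i k, a t ω = Action.comm i k} = pcomm := by
  have hU : {ω | ∃ i k, a t ω = Action.comm i k}
      = ⋃ k, {ω | ∃ i, a t ω = Action.comm i k} := by
    ext ω
    simp only [Set.mem_ofPred_eq, Set.mem_iUnion]
    exact exists_comm
  rw [hU, measureReal_iUnion_fintype]
  · simp only [prob_jump ha hn, Finset.sum_const, Finset.card_univ, Fintype.card_fin, nsmul_eq_mul]
    have : (K : ℝ) ≠ 0 := (Nat.cast_pos.2 hK).ne'
    field_simp
  · rintro k l hkl
    refine Set.disjoint_left.2 ?_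
    rintro ω ⟨i, h1⟩ ⟨j, h2⟩
    exact hkl (Action.comm.inj (h1.symm.trans h2)).2
  · exact fun k => ha.measurableSet (fun b => ∃ i, b = Action.comm i k) t

lemma integral_totalComms [IsProbabilityMeasure P]
    (ha : IsSampling P pcomm pcomp a) (hn : 0 < n) (hK : 0 < K) (T : ℕ) :
    ∫ ω, (totalComms (fun s => a s ω) T : ℝ) ∂P = T * pcomm := by
  have h := integral_card_filter (P := P) (a := a) (fun b => ∃ i k, b = Action.comm i k)
    (fun t => ha.measurableSet (fun b => ∃ i k, b = Action.comm i k) t) T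
  simp only [prob_comm ha hn hK, Finset.sum_const, Finset.card_range, nsmul_eq_mul] at h
  rw [← h]
  unfold totalComms
  congr!

end Sampling

section Convergence

variable {d n K : ℕ}

/-! ### Conservation of the total flow -/

lemma sum_flow_commStep (μ : ℝ) (f : Fin n → Vec d → ℝ) (θs : Vec d) (ρ : ℝ) (i : Fin n)
    (k : Fin K) (s : State d n K) :
    ∑ j, nodeFlow μ f θs (commStep ρ i k s) j + ∑ l, tokenFlow μ θs (commStep ρ i k s) l
      = ∑ j, nodeFlow μ f θs s j + ∑ l, tokenFlow μ θs s l := by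
  rw [nodeFlow_commStep, tokenFlow_commStep, sum_comp_update (fun _ w => w),
    sum_comp_update (fun _ w => w)]
  abel

lemma sigmaTilde_pos (hn : 0 < n) {σ : ℝ} (hσ : 0 < σ) : 0 < sigmaTilde n K σ := by
  have : (0 : ℝ) < n := Nat.cast_pos.2 hn
  unfold sigmaTilde
  positivity

lemma nodeFlow_initState {σ : ℝ} (hμ : sigmaTilde n K σ ≠ 0) (f : Fin n → Vec d → ℝ)
    (θs : Vec d) (z₀ : Fin n → Vec d) (i : Fin n) :
    nodeFlow (sigmaTilde n K σ) f θs (initState K σ f z₀) i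
      = -(sigmaTilde n K σ • θs + gradient (f i) θs) := by
  simp only [nodeFlow, initState, smul_sub, smul_neg, smul_inv_smul₀ hμ]
  abel

lemma tokenFlow_initState (σ μ : ℝ) (f : Fin n → Vec d → ℝ)
    (θs : Vec d) (z₀ : Fin n → Vec d) (k : Fin K) :
    tokenFlow μ θs (initState K σ f z₀) k = -(μ • θs) := by
  simp [tokenFlow, initState]

lemma sum_flow_initState (hn : 0 < n) {σ : ℝ} (hσ : 0 < σ) {f : Fin n → Vec d → ℝ}
    (hf : ∀ i, Differentiable ℝ (f i)) {θs : Vec d}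
    (hθs : IsMinOn (objective σ f) Set.univ θs) (z₀ : Fin n → Vec d) :
    ∑ i, nodeFlow (sigmaTilde n K σ) f θs (initState K σ f z₀) i
      + ∑ k, tokenFlow (sigmaTilde n K σ) θs (initState K σ f z₀) k = 0 := by
  have h := sum_gradient_minimizer hf hθs
  have hsum : (n : ℝ) * σ = (n + K) * sigmaTilde n K σ := by
    have : (0 : ℝ) < n := Nat.cast_pos.2 hn
    unfold sigmaTilde
    field_simp
  simp only [nodeFlow_initState (sigmaTilde_pos hn hσ).ne', tokenFlow_initState,
    Finset.sum_neg_distrib, Finset.sum_add_distrib, Finset.sum_const, Finset.card_univ,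
    Fintype.card_fin, ← Nat.cast_smul_eq_nsmul ℝ]
  rw [hsum] at h
  rw [← neg_zero, ← h]
  module

/-- The flows keep a total sum of zero, which holds initially by optimality of `θs`. -/
lemma sum_flow_iterate (hn : 0 < n) {σ : ℝ} (hσ : 0 < σ) {f : Fin n → Vec d → ℝ}
    (hf : ∀ i, Differentiable ℝ (f i)) {θs : Vec d}
    (hθs : IsMinOn (objective σ f) Set.univ θs) (L α pcomm pcomp : ℝ) (z₀ : Fin n → Vec d)
    (a : ℕ → Action n K) (t : ℕ) :
    ∑ i, nodeFlow (sigmaTilde n K σ) f θs (iterate σ L α pcomm pcomp f z₀ a t) i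
      + ∑ k, tokenFlow (sigmaTilde n K σ) θs (iterate σ L α pcomm pcomp f z₀ a t) k = 0 := by
  induction t with
  | zero => exact sum_flow_initState hn hσ hf hθs z₀
  | succ t ih =>
    rw [iterate]
    cases a t with
    | comm i k => rw [step, sum_flow_commStep, ih]
    | comp i =>
      rw [step, nodeFlow_compStep (sigmaTilde_pos hn hσ).ne']
      exact ih

/-! ### The parameters of the algorithm -/

lemma sigmaTilde_le (hn : 0 < n) {σ : ℝ} (hσ : 0 < σ) : sigmaTilde n K σ ≤ σ := by
  have : (0 : ℝ) < n := Nat.cast_pos.2 hn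
  have h : (n : ℝ) / (n + K) ≤ 1 := by
    rw [div_le_one (by positivity)]
    have : (0 : ℝ) ≤ K := Nat.cast_nonneg K
    linarith
  exact mul_le_of_le_one_left hσ.le h

lemma le_two_mul_sigmaTilde (hn : 0 < n) (hKn : K ≤ n) {σ : ℝ} (hσ : 0 < σ) :
    σ ≤ 2 * sigmaTilde n K σ := by
  have : (0 : ℝ) < n := Nat.cast_pos.2 hn
  have hKn' : (K : ℝ) ≤ n := Nat.cast_le.2 hKn
  unfold sigmaTilde
  rw [div_mul_eq_mul_div, mul_div_assoc', le_div_iff₀ (by positivity)]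
  nlinarith

/-- The bounds on `α` that the convergence proof uses. The second choice of `α` satisfies the last
one because `σ̃ ≤ σ ≤ L`. -/
lemma alpha_bounds (hn : 0 < n) (hK : 0 < K) {σ L α : ℝ} (hσ : 0 < σ) (hL : 0 < L)
    (hα : α = 2 * K / (L + sigmaTilde n K σ) ∨ (σ ≤ L ∧ α = 2 * K / L)) :
    0 < α ∧ 1 / α ≤ (L + sigmaTilde n K σ) / (2 * K)
      ∧ α * (1 + L / sigmaTilde n K σ) ≤ 4 * K / sigmaTilde n K σ := by
  have hK' : (0 : ℝ) < K := Nat.cast_pos.2 hK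
  have hμ := sigmaTilde_pos (K := K) hn hσ
  have hμσ := sigmaTilde_le (K := K) hn hσ
  set μ := sigmaTilde n K σ
  rcases hα with rfl | ⟨hσL, rfl⟩
  · refine ⟨by positivity, by rw [one_div_div], ?_⟩
    rw [show 2 * (K : ℝ) / (L + μ) * (1 + L / μ) = 2 * K / μ by field_simp; ring]
    gcongr
    norm_num
  · refine ⟨by positivity, ?_, ?_⟩
    · rw [one_div_div]
      gcongr
      linarith
    · rw [show 2 * (K : ℝ) / L * (1 + L / μ) = 2 * K * (μ + L) / L / μ by field_simp]
      gcongr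
      rw [div_le_iff₀ hL]
      nlinarith

/-- The step-size is `σ̃ / (n K)` up to universal constants. -/
lemma eta_bounds (hn : 0 < n) (hK : 0 < K) {σ L α : ℝ} (hσ : 0 < σ) (hL : 0 < L)
    (hα : α = 2 * K / (L + sigmaTilde n K σ) ∨ (σ ≤ L ∧ α = 2 * K / L)) :
    sigmaTilde n K σ / (8 * n * K) ≤ eta n K σ L α (1 / 2) (1 / 2)
      ∧ 4 * n * eta n K σ L α (1 / 2) (1 / 2) ≤ sigmaTilde n K σ / K
      ∧ 2 * n * α * eta n K σ L α (1 / 2) (1 / 2) * (1 + L / sigmaTilde n K σ) ≤ 1 := by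
  have hn' : (0 : ℝ) < n := Nat.cast_pos.2 hn
  have hK' : (0 : ℝ) < K := Nat.cast_pos.2 hK
  have hμ := sigmaTilde_pos (K := K) hn hσ
  obtain ⟨hα0, -, hα2⟩ := alpha_bounds hn hK hσ hL hα
  unfold eta
  set μ := sigmaTilde n K σ
  refine ⟨le_min ?_ ?_, ?_, ?_⟩
  · rw [div_le_div_iff₀ (by positivity) (by positivity)]
    have : 0 < μ * n * K := by positivity
    linarith
  · calc μ / (8 * n * K) = 1 / 2 / (n * (4 * K / μ)) := by field_simp; norm_num
      _ ≤ 1 / 2 / (n * (α * (1 + L / μ))) := by gcongr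
      _ = _ := by rw [mul_assoc]
  · calc _ ≤ 4 * n * (μ * (1 / 2) / (2 * n * K)) := by
          gcongr
          exact min_le_left _ _
      _ = μ / K := by field_simp; norm_num
  · calc _ ≤ 2 * n * α * (1 / 2 / (n * α * (1 + L / μ))) * (1 + L / μ) := by
          gcongr
          exact min_le_right _ _
      _ = 1 := by
          have : 0 < 1 + L / μ := by positivity
          field_simp

/-! ### Contraction of the expected Lyapunov function -/

lemma dualGap_le_lyapunov (hn : 0 < n) (hK : 0 < K) {L α : ℝ} (hα : 0 < α) (μ η : ℝ)
    {f : Fin n → Vec d → ℝ} (hconv : ∀ i, ConvexOn ℝ Set.univ (f i))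
    (hsmooth : ∀ i, LSmooth L (f i)) (θs : Vec d) (s : State d n K) :
    4 * η * n * dualGap μ f θs s ≤ lyapunov μ α η f θs s := by
  have hA := virtGap_nonneg hconv hsmooth θs s
  have hQ := flowEnergy_nonneg hn hK μ f θs s
  have hA' : 0 ≤ virtGap f θs s / α := by positivity
  unfold lyapunov
  linarith

lemma norm_token_sub_sq_le (hn : 0 < n) (hK : 0 < K) {μ L α η : ℝ} (hμ : 0 < μ) (hα : 0 < α)
    (hη : μ / (8 * n * K) ≤ η) {f : Fin n → Vec d → ℝ}
    (hconv : ∀ i, ConvexOn ℝ Set.univ (f i))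
    (hsmooth : ∀ i, LSmooth L (f i)) (θs : Vec d) (s : State d n K) (k : Fin K) :
    ‖s.token k - θs‖ ^ 2 ≤ 4 * K / μ ^ 2 * lyapunov μ α η f θs s := by
  have hn' : (0 : ℝ) < n := Nat.cast_pos.2 hn
  have hK' : (0 : ℝ) < K := Nat.cast_pos.2 hK
  have h1 := dualGap_le_lyapunov hn hK hα μ η hconv hsmooth θs s
  have h2 := dualGap_nonneg hμ.le hconv hsmooth θs s
  have hB := virtGapSwap_nonneg hconv hsmooth θs s
  have hS : ‖s.token k - θs‖ ^ 2 ≤ sqDist θs s := by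
    have h3 : ‖s.token k - θs‖ ^ 2 ≤ ∑ k, ‖s.token k - θs‖ ^ 2 :=
      Finset.single_le_sum (f := fun k => ‖s.token k - θs‖ ^ 2) (fun _ _ => sq_nonneg _)
        (Finset.mem_univ k)
    have h4 : 0 ≤ ∑ i, ‖s.node i - θs‖ ^ 2 := by positivity
    unfold sqDist
    linarith
  calc ‖s.token k - θs‖ ^ 2 ≤ sqDist θs s := hS
    _ = 2 / μ * (μ / 2 * sqDist θs s) := by field_simp
    _ ≤ 2 / μ * dualGap μ f θs s := by
        gcongr
        unfold dualGap
        linarith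
    _ = 4 * K / μ ^ 2 * (4 * (μ / (8 * n * K)) * n * dualGap μ f θs s) := by
        field_simp
        ring
    _ ≤ 4 * K / μ ^ 2 * (4 * η * n * dualGap μ f θs s) := by gcongr
    _ ≤ _ := by gcongr

/-- The expected Lyapunov function is multiplied by at most `1 - 1 / (48 n κ)` in each iteration. -/
lemma integral_lyapunov_succ_le (hK : 0 < K) (hKn : K ≤ n) {σ L α : ℝ} (hσ : 0 < σ)
    (hL : 0 < L) (hα : α = 2 * K / (L + sigmaTilde n K σ) ∨ (σ ≤ L ∧ α = 2 * K / L))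
    {f : Fin n → Vec d → ℝ} (hconv : ∀ i, ConvexOn ℝ Set.univ (f i))
    (hsmooth : ∀ i, LSmooth L (f i)) {θs : Vec d}
    (hθs : IsMinOn (objective σ f) Set.univ θs) (z₀ : Fin n → Vec d)
    {Ω : Type*} [MeasurableSpace Ω] {P : Measure Ω} [IsProbabilityMeasure P]
    {a : ℕ → Ω → Action n K} (ha : IsSampling P (1 / 2) (1 / 2) a) (t : ℕ) :
    ∫ ω, lyapunov (sigmaTilde n K σ) α (eta n K σ L α (1 / 2) (1 / 2)) f θs
        (iterate σ L α (1 / 2) (1 / 2) f z₀ (fun s => a s ω) (t + 1)) ∂P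
      ≤ (1 - 1 / (48 * n * condNumber L σ))
        * ∫ ω, lyapunov (sigmaTilde n K σ) α (eta n K σ L α (1 / 2) (1 / 2)) f θs
        (iterate σ L α (1 / 2) (1 / 2) f z₀ (fun s => a s ω) t) ∂P := by
  have hn : 0 < n := hK.trans_le hKn
  have hn' : (0 : ℝ) < n := Nat.cast_pos.2 hn
  have hK' : (0 : ℝ) < K := Nat.cast_pos.2 hK
  have hμ := sigmaTilde_pos (K := K) hn hσ
  have hμ2 := le_two_mul_sigmaTilde hn hKn hσ
  obtain ⟨hα0, hα1, hα2⟩ := alpha_bounds hn hK hσ hL hα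
  obtain ⟨hη1, hη2, hη3⟩ := eta_bounds hn hK hσ hL hα
  rw [integral_iterate_succ hn ha σ L α f z₀ t
    (lyapunov (sigmaTilde n K σ) α (eta n K σ L α (1 / 2) (1 / 2)) f θs), ← integral_const_mul]
  have hρη : rhoComm n K σ L α (1 / 2) (1 / 2) * sigmaTilde n K σ
      = 2 * n * K * eta n K σ L α (1 / 2) (1 / 2) := by
    unfold rhoComm
    field_simp
  have hρη' : rhoComp n K σ L α (1 / 2) (1 / 2)
      = 2 * n * α * eta n K σ L α (1 / 2) (1 / 2) := by
    unfold rhoComp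
    ring
  have hρ1 : rhoComp n K σ L α (1 / 2) (1 / 2) * (1 + L / sigmaTilde n K σ) ≤ 1 := by
    rw [hρη']
    exact hη3
  set μ := sigmaTilde n K σ with hμdef
  set η := eta n K σ L α (1 / 2) (1 / 2) with hηdef
  have hη0 : 0 < η := lt_of_lt_of_le (by positivity) hη1
  have hρ : rhoComm n K σ L α (1 / 2) (1 / 2) ≤ 1 / 2 := by
    refine le_of_mul_le_mul_right ?_ hμ
    rw [hρη]
    rw [le_div_iff₀ hK'] at hη2
    linarith
  refine integral_mono ?_ ?_ fun ω => ?_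
  · exact integrable_iterate hn ha σ L α f z₀ t fun s =>
      1 / 2 / (n * K) * (∑ i, ∑ k, lyapunov μ α η f θs
        (commStep (rhoComm n K σ L α (1 / 2) (1 / 2)) i k s))
      + 1 / 2 / n * ∑ i, lyapunov μ α η f θs
        (compStep σ (rhoComp n K σ L α (1 / 2) (1 / 2)) f i s)
  · exact integrable_iterate hn ha σ L α f z₀ t fun s =>
      (1 - 1 / (48 * n * condNumber L σ)) * lyapunov μ α η f θs s
  · have h1 := lyapunov_mean_le hn hK hKn hμ hL hconv hsmooth hα0 hη0 hρ hρη hρη' hρ1 θs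
      (iterate σ L α (1 / 2) (1 / 2) f z₀ (fun s => a s ω) t)
      (sum_flow_iterate hn hσ (fun i => (hsmooth i).1) hθs L α _ _ z₀ _ t)
    refine h1.trans ?_
    generalize iterate σ L α (1 / 2) (1 / 2) f z₀ (fun s => a s ω) t = s
    have h2 := lyapunov_le hn hK hKn hμ hL hconv hsmooth hα1 hη2 θs s
    have hS := sqDist_nonneg θs s
    have hA := virtGap_nonneg hconv hsmooth θs s
    have hB := virtGapSwap_nonneg hconv hsmooth θs s
    have hκ : 0 < condNumber L σ := by unfold condNumber; positivity
    have hM : 0 ≤ μ * sqDist θs s + virtGap f θs s + virtGapSwap f θs s := by positivity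
    have h3 : 1 / (48 * n * condNumber L σ) * (3 * (L + μ) / K) ≤ η := by
      refine le_trans ?_ hη1
      unfold condNumber
      rw [show 1 / (48 * n * (1 + L / σ)) * (3 * (L + μ) / K)
        = σ * (L + μ) / (2 * (σ + L)) / (8 * n * K) by field_simp; ring]
      gcongr
      rw [div_le_iff₀ (by positivity)]
      nlinarith
    have h4 : 1 / (48 * n * condNumber L σ) * lyapunov μ α η f θs s
        ≤ η * (μ * sqDist θs s + virtGap f θs s + virtGapSwap f θs s) := by
      calc _ ≤ 1 / (48 * n * condNumber L σ) * (3 * (L + μ) / K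
            * (μ * sqDist θs s + virtGap f θs s + virtGapSwap f θs s)) := by gcongr
        _ = 1 / (48 * n * condNumber L σ) * (3 * (L + μ) / K)
            * (μ * sqDist θs s + virtGap f θs s + virtGapSwap f θs s) := by ring
        _ ≤ _ := by gcongr
    linarith

/-! ### The initial value of the Lyapunov function -/

/-- The optimal flows through the nodes, measured with `σ̃` in place of `σ`. -/
lemma sum_norm_optimal_flow_sq_le (hn : 0 < n) (hKn : K ≤ n) (σ : ℝ) (f : Fin n → Vec d → ℝ)
    (θs : Vec d) :
    ∑ i, ‖θs + (sigmaTilde n K σ)⁻¹ • gradient (f i) θs‖ ^ 2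
      ≤ 8 * ∑ i, ‖θs + σ⁻¹ • gradient (f i) θs‖ ^ 2 + 2 * (n * ‖θs‖ ^ 2) := by
  have hn' : (0 : ℝ) < n := Nat.cast_pos.2 hn
  have hKn' : (K : ℝ) ≤ n := Nat.cast_le.2 hKn
  have hμσ : (sigmaTilde n K σ)⁻¹ = (1 + K / n) * σ⁻¹ := by
    unfold sigmaTilde
    rw [mul_inv, inv_div, add_div, div_self hn'.ne']
  have hc : (n : ℝ) * ‖θs‖ ^ 2 = ∑ _i : Fin n, ‖θs‖ ^ 2 := by simp
  rw [hc, Finset.mul_sum, Finset.mul_sum, ← Finset.sum_add_distrib, hμσ]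
  refine Finset.sum_le_sum fun i _ => ?_
  have e : θs + ((1 + (K : ℝ) / n) * σ⁻¹) • gradient (f i) θs
      = (1 + (K : ℝ) / n) • (θs + σ⁻¹ • gradient (f i) θs) - ((K : ℝ) / n) • θs := by
    module
  have hr0 : 0 ≤ (K : ℝ) / n := by positivity
  have hr1 : (K : ℝ) / n ≤ 1 := (div_le_one hn').2 hKn'
  have h1 := norm_sub_le ((1 + (K : ℝ) / n) • (θs + σ⁻¹ • gradient (f i) θs))
    (((K : ℝ) / n) • θs)
  rw [← e, norm_smul, norm_smul, Real.norm_of_nonneg hr0,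
    Real.norm_of_nonneg (by linarith)] at h1
  have h2 : (1 + (K : ℝ) / n) * ‖θs + σ⁻¹ • gradient (f i) θs‖
      ≤ 2 * ‖θs + σ⁻¹ • gradient (f i) θs‖ := by
    gcongr
    linarith
  have h3 : (K : ℝ) / n * ‖θs‖ ≤ 1 * ‖θs‖ := by gcongr
  calc ‖θs + ((1 + (K : ℝ) / n) * σ⁻¹) • gradient (f i) θs‖ ^ 2
      ≤ (2 * ‖θs + σ⁻¹ • gradient (f i) θs‖ + ‖θs‖) ^ 2 := by
        gcongr
        linarith
    _ ≤ 2 * ((2 * ‖θs + σ⁻¹ • gradient (f i) θs‖) ^ 2 + ‖θs‖ ^ 2) := add_sq_le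
    _ = _ := by ring

lemma flowEnergy_initState_le (hK : 0 < K) (hKn : K ≤ n) {σ : ℝ} (hσ : 0 < σ)
    (f : Fin n → Vec d → ℝ) (θs : Vec d) (z₀ : Fin n → Vec d) :
    2 * K / sigmaTilde n K σ ^ 2 * flowEnergy (sigmaTilde n K σ) f θs (initState K σ f z₀)
      ≤ 16 * ∑ i, ‖θs + σ⁻¹ • gradient (f i) θs‖ ^ 2 + 6 * (n * ‖θs‖ ^ 2) := by
  have hn : 0 < n := hK.trans_le hKn
  have hn' : (0 : ℝ) < n := Nat.cast_pos.2 hn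
  have hK' : (0 : ℝ) < K := Nat.cast_pos.2 hK
  have hKn' : (K : ℝ) ≤ n := Nat.cast_le.2 hKn
  have hμ := sigmaTilde_pos (K := K) hn hσ
  have hflow := sum_norm_optimal_flow_sq_le hn hKn σ f θs
  have h3 := flowEnergy_le (sigmaTilde n K σ) f θs (initState K σ f z₀)
  have h1 : ∑ i, ‖nodeFlow (sigmaTilde n K σ) f θs (initState K σ f z₀) i‖ ^ 2
      = sigmaTilde n K σ ^ 2 * ∑ i, ‖θs + (sigmaTilde n K σ)⁻¹ • gradient (f i) θs‖ ^ 2 := by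
    rw [Finset.mul_sum]
    refine Finset.sum_congr rfl fun i _ => ?_
    rw [nodeFlow_initState hμ.ne', norm_neg,
      show sigmaTilde n K σ • θs + gradient (f i) θs
        = sigmaTilde n K σ • (θs + (sigmaTilde n K σ)⁻¹ • gradient (f i) θs) by
        rw [smul_add, smul_inv_smul₀ hμ.ne'], norm_smul, mul_pow, Real.norm_eq_abs, sq_abs]
  have h2 : ∑ k, ‖tokenFlow (sigmaTilde n K σ) θs (initState K σ f z₀) k‖ ^ 2
      = K * (sigmaTilde n K σ ^ 2 * ‖θs‖ ^ 2) := by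
    simp only [tokenFlow_initState, norm_neg, norm_smul, mul_pow, Real.norm_eq_abs, sq_abs,
      Finset.sum_const, Finset.card_univ, Fintype.card_fin, nsmul_eq_mul]
  rw [h1, h2] at h3
  generalize flowEnergy (sigmaTilde n K σ) f θs (initState K σ f z₀) = Q at *
  generalize ∑ i, ‖θs + (sigmaTilde n K σ)⁻¹ • gradient (f i) θs‖ ^ 2 = H at *
  generalize ∑ i, ‖θs + σ⁻¹ • gradient (f i) θs‖ ^ 2 = G at *
  generalize sigmaTilde n K σ = μ at *
  calc 2 * K / μ ^ 2 * Q
      ≤ 2 * K / μ ^ 2 * (μ ^ 2 * H / K + K * (μ ^ 2 * ‖θs‖ ^ 2) / n) := by gcongr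
    _ = 2 * H + 2 * (K * K * ‖θs‖ ^ 2 / n) := by
        field_simp
    _ ≤ 2 * (8 * G + 2 * (n * ‖θs‖ ^ 2)) + 2 * (n * n * ‖θs‖ ^ 2 / n) := by gcongr
    _ = _ := by
        field_simp
        ring

lemma sqDist_initState_le (hn : 0 < n) (hKn : K ≤ n) {σ L : ℝ} (hσ : 0 < σ)
    {f : Fin n → Vec d → ℝ} (hsmooth : ∀ i, LSmooth L (f i)) (θs : Vec d)
    (z₀ : Fin n → Vec d) :
    sqDist θs (initState K σ f z₀) ≤ 16 * ∑ i, ‖θs + σ⁻¹ • gradient (f i) θs‖ ^ 2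
      + 5 * (n * ‖θs‖ ^ 2) + 2 * ((L / sigmaTilde n K σ) ^ 2 * ∑ i, ‖z₀ i - θs‖ ^ 2) := by
  have hμ := sigmaTilde_pos (K := K) hn hσ
  have hflow := sum_norm_optimal_flow_sq_le hn hKn σ f θs
  set μ := sigmaTilde n K σ with hμdef
  have h1 : ∑ k : Fin K, ‖(initState K σ f z₀).token k - θs‖ ^ 2 ≤ n * ‖θs‖ ^ 2 := by
    simp only [initState, zero_sub, norm_neg, Finset.sum_const, Finset.card_univ,
      Fintype.card_fin, nsmul_eq_mul]
    gcongr
  have h2 : ∑ i, ‖(initState K σ f z₀).node i - θs‖ ^ 2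
      ≤ 2 * (∑ i, ‖θs + μ⁻¹ • gradient (f i) θs‖ ^ 2)
        + 2 * ((L / μ) ^ 2 * ∑ i, ‖z₀ i - θs‖ ^ 2) := by
    rw [Finset.mul_sum, Finset.mul_sum, Finset.mul_sum, ← Finset.sum_add_distrib]
    refine Finset.sum_le_sum fun i _ => ?_
    have e : (initState K σ f z₀).node i - θs = -(θs + μ⁻¹ • gradient (f i) θs)
        - μ⁻¹ • (gradient (f i) (z₀ i) - gradient (f i) θs) := by
      simp only [initState, ← hμdef]
      module
    have h3 := norm_sub_le (-(θs + μ⁻¹ • gradient (f i) θs))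
      (μ⁻¹ • (gradient (f i) (z₀ i) - gradient (f i) θs))
    rw [← e, norm_neg, norm_smul, Real.norm_of_nonneg (by positivity)] at h3
    have h4 : μ⁻¹ * ‖gradient (f i) (z₀ i) - gradient (f i) θs‖ ≤ L / μ * ‖z₀ i - θs‖ := by
      rw [div_eq_inv_mul, mul_assoc]
      gcongr
      exact (hsmooth i).2 _ _
    calc ‖(initState K σ f z₀).node i - θs‖ ^ 2
        ≤ (‖θs + μ⁻¹ • gradient (f i) θs‖ + L / μ * ‖z₀ i - θs‖) ^ 2 := by
          gcongr
          linarith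
      _ ≤ 2 * (‖θs + μ⁻¹ • gradient (f i) θs‖ ^ 2 + (L / μ * ‖z₀ i - θs‖) ^ 2) := add_sq_le
      _ = _ := by ring
  unfold sqDist
  linarith

/-- The initial value of the Lyapunov function, in the normalization of
`norm_token_sub_sq_le`. -/
lemma lyapunov_initState_le (hK : 0 < K) (hKn : K ≤ n) {σ L α η : ℝ} (hσ : 0 < σ)
    (hL : 0 < L) (hα : 1 / α ≤ (L + sigmaTilde n K σ) / (2 * K))
    (hη : 4 * n * η ≤ sigmaTilde n K σ / K)
    {f : Fin n → Vec d → ℝ} (hconv : ∀ i, ConvexOn ℝ Set.univ (f i))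
    (hsmooth : ∀ i, LSmooth L (f i)) (θs : Vec d) (z₀ : Fin n → Vec d) :
    4 * K / sigmaTilde n K σ ^ 2
        * lyapunov (sigmaTilde n K σ) α η f θs (initState K σ f z₀)
      ≤ 48 * initGap σ L f z₀ θs := by
  have hn : 0 < n := hK.trans_le hKn
  have hK' : (0 : ℝ) < K := Nat.cast_pos.2 hK
  have hμ := sigmaTilde_pos (K := K) hn hσ
  have hμ2 := le_two_mul_sigmaTilde hn hKn hσ
  have hQ := flowEnergy_initState_le hK hKn hσ f θs z₀
  have hS := sqDist_initState_le hn hKn hσ hsmooth θs z₀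
  have hA0 := virtGap_nonneg hconv hsmooth θs (initState K σ f z₀)
  have hD0 := dualGap_nonneg hμ.le hconv hsmooth θs (initState K σ f z₀)
  have hA : virtGap f θs (initState K σ f z₀) ≤ L / 2 * ∑ i, ‖z₀ i - θs‖ ^ 2 := by
    rw [Finset.mul_sum]
    exact Finset.sum_le_sum fun i _ => bregman_le (hsmooth i).1 (hsmooth i).2 _ _
  have hB : virtGapSwap f θs (initState K σ f z₀) ≤ L / 2 * ∑ i, ‖z₀ i - θs‖ ^ 2 := by
    rw [Finset.mul_sum]
    refine Finset.sum_le_sum fun i _ => ?_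
    have h := bregman_le (hsmooth i).1 (hsmooth i).2 θs (z₀ i)
    rw [norm_sub_rev] at h
    exact h
  have hD : dualGap (sigmaTilde n K σ) f θs (initState K σ f z₀)
      ≤ sigmaTilde n K σ / 2 * sqDist θs (initState K σ f z₀)
        + L / 2 * ∑ i, ‖z₀ i - θs‖ ^ 2 := by
    unfold dualGap
    linarith
  have hZ0 : 0 ≤ ∑ i, ‖z₀ i - θs‖ ^ 2 := by positivity
  have hG0 : 0 ≤ ∑ i, ‖θs + σ⁻¹ • gradient (f i) θs‖ ^ 2 := by positivity
  have hN : 0 ≤ (n : ℝ) * ‖θs‖ ^ 2 := by positivity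
  have hLμ : L / sigmaTilde n K σ ≤ 2 * (L / σ) := by
    rw [mul_div_assoc', div_le_div_iff₀ hμ hσ]
    nlinarith
  have hLσ : 0 < L / σ := by positivity
  unfold lyapunov initGap condNumber
  generalize dualGap (sigmaTilde n K σ) f θs (initState K σ f z₀) = E at *
  generalize flowEnergy (sigmaTilde n K σ) f θs (initState K σ f z₀) = Q at *
  generalize virtGap f θs (initState K σ f z₀) = A at *
  generalize sqDist θs (initState K σ f z₀) = S at *
  generalize ∑ i, ‖z₀ i - θs‖ ^ 2 = Z at *
  generalize ∑ i, ‖θs + σ⁻¹ • gradient (f i) θs‖ ^ 2 = G at *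
  generalize (n : ℝ) * ‖θs‖ ^ 2 = N at *
  generalize sigmaTilde n K σ = μ at *
  have hA' : 4 * K / μ ^ 2 * (A / α) ≤ (1 + L / μ) * (L / μ) * Z := by
    calc 4 * K / μ ^ 2 * (A / α) = 4 * K / μ ^ 2 * (1 / α * A) := by ring
      _ ≤ 4 * K / μ ^ 2 * ((L + μ) / (2 * K) * (L / 2 * Z)) := by gcongr
      _ = (1 + L / μ) * (L / μ) * Z := by
          field_simp
          ring
  have hE : 4 * K / μ ^ 2 * (4 * η * n * E) ≤ 2 * S + 2 * (L / μ) * Z := by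
    calc 4 * K / μ ^ 2 * (4 * η * n * E) ≤ 4 * K / μ ^ 2 * (μ / K * E) := by
          gcongr
          linarith
      _ ≤ 4 * K / μ ^ 2 * (μ / K * (μ / 2 * S + L / 2 * Z)) := by gcongr
      _ = 2 * S + 2 * (L / μ) * Z := by
          field_simp
          ring
  have hr0 : 0 < L / μ := by positivity
  have hκ1 : (1 + L / μ) * (L / μ) + 2 * (L / μ) + 4 * (L / μ) ^ 2 ≤ 48 * (1 + L / σ) ^ 2 := by
    nlinarith
  have hκ2 := mul_le_mul_of_nonneg_right hκ1 hZ0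
  calc 4 * K / μ ^ 2 * (Q / 2 + A / α + 4 * η * n * E)
      = 2 * K / μ ^ 2 * Q + 4 * K / μ ^ 2 * (A / α) + 4 * K / μ ^ 2 * (4 * η * n * E) := by ring
    _ ≤ 48 * ((1 + L / σ) ^ 2 * Z + G + N) := by linarith

/-! ### Convergence of the tokens and complexity -/

lemma integral_norm_token_sub_sq_le (hK : 0 < K) (hKn : K ≤ n) {σ L α : ℝ} (hσ : 0 < σ)
    (hL : 0 < L) (hα : α = 2 * K / (L + sigmaTilde n K σ) ∨ (σ ≤ L ∧ α = 2 * K / L))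
    {f : Fin n → Vec d → ℝ} (hconv : ∀ i, ConvexOn ℝ Set.univ (f i))
    (hsmooth : ∀ i, LSmooth L (f i)) {θs : Vec d}
    (hθs : IsMinOn (objective σ f) Set.univ θs) (z₀ : Fin n → Vec d)
    {Ω : Type*} [MeasurableSpace Ω] {P : Measure Ω} [IsProbabilityMeasure P]
    {a : ℕ → Ω → Action n K} (ha : IsSampling P (1 / 2) (1 / 2) a) (t : ℕ) (k : Fin K) :
    ∫ ω, ‖(iterate σ L α (1 / 2) (1 / 2) f z₀ (fun s => a s ω) t).token k - θs‖ ^ 2 ∂P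
      ≤ 48 * initGap σ L f z₀ θs * (1 - 1 / (48 * n * condNumber L σ)) ^ t := by
  have hn : 0 < n := hK.trans_le hKn
  have hn' : (1 : ℝ) ≤ n := Nat.one_le_cast.2 hn
  have hμ := sigmaTilde_pos (K := K) hn hσ
  obtain ⟨hα0, hα1, hα2⟩ := alpha_bounds hn hK hσ hL hα
  obtain ⟨hη1, hη2, hη3⟩ := eta_bounds hn hK hσ hL hα
  have hr : 0 ≤ 1 - 1 / (48 * n * condNumber L σ) := by
    have hκ1 : 1 ≤ condNumber L σ := by
      rw [condNumber, le_add_iff_nonneg_right]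
      positivity
    rw [sub_nonneg, div_le_one (by positivity)]
    nlinarith
  set μ := sigmaTilde n K σ with hμdef
  set η := eta n K σ L α (1 / 2) (1 / 2) with hηdef
  have hdecay : ∫ ω, lyapunov μ α η f θs
      (iterate σ L α (1 / 2) (1 / 2) f z₀ (fun s => a s ω) t) ∂P
      ≤ (1 - 1 / (48 * n * condNumber L σ)) ^ t
        * lyapunov μ α η f θs (initState K σ f z₀) := by
    induction t with
    | zero => simp [iterate]
    | succ t ih =>
      refine (integral_lyapunov_succ_le hK hKn hσ hL hα hconv hsmooth hθs z₀ ha t).trans ?_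
      exact (mul_le_mul_of_nonneg_left ih hr).trans_eq (by ring)
  calc _ ≤ ∫ ω, 4 * K / μ ^ 2 * lyapunov μ α η f θs
        (iterate σ L α (1 / 2) (1 / 2) f z₀ (fun s => a s ω) t) ∂P := by
        refine integral_mono ?_ ?_ fun ω => ?_
        · exact integrable_iterate hn ha σ L α f z₀ t fun s => ‖s.token k - θs‖ ^ 2
        · exact integrable_iterate hn ha σ L α f z₀ t fun s =>
            4 * K / μ ^ 2 * lyapunov μ α η f θs s
        · exact norm_token_sub_sq_le hn hK hμ hα0 hη1 hconv hsmooth θs _ k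
    _ = 4 * K / μ ^ 2 * ∫ ω, lyapunov μ α η f θs
        (iterate σ L α (1 / 2) (1 / 2) f z₀ (fun s => a s ω) t) ∂P := integral_const_mul _ _
    _ ≤ 4 * K / μ ^ 2 * ((1 - 1 / (48 * n * condNumber L σ)) ^ t
        * lyapunov μ α η f θs (initState K σ f z₀)) := by gcongr
    _ = 4 * K / μ ^ 2 * lyapunov μ α η f θs (initState K σ f z₀)
        * (1 - 1 / (48 * n * condNumber L σ)) ^ t := by ring
    _ ≤ _ := mul_le_mul_of_nonneg_right
        (lyapunov_initState_le hK hKn hσ hL hα1 hη2 hconv hsmooth θs z₀) (pow_nonneg hr t)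

/-- After `c (4 + log⁺ (D / ε))` steps of linear convergence at rate `1 - 1 / c`, the error `48 D`
has decreased to `ε`; the constant `4` comes from `48 ≤ exp 4`. -/
lemma mul_one_sub_pow_le {D ε c : ℝ} (hD : 0 ≤ D) (hε : 0 < ε) (hc : 1 ≤ c) {t : ℕ}
    (ht : c * (4 + Real.posLog (D / ε)) ≤ t) : 48 * D * (1 - 1 / c) ^ t ≤ ε := by
  rcases hD.eq_or_lt with rfl | hD
  · simpa using hε.le
  have hc0 : 0 < c := by linarith
  have h1 : (1 - 1 / c) ^ t ≤ Real.exp (-(4 + Real.log (D / ε))) := by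
    have h2 : 1 - 1 / c ≤ Real.exp (-(1 / c)) := Real.one_sub_le_exp_neg _
    have h3 : 0 ≤ 1 - 1 / c := sub_nonneg.2 ((div_le_one hc0).2 hc)
    refine (pow_le_pow_left₀ h3 h2 t).trans ?_
    rw [← Real.exp_nat_mul, Real.exp_le_exp, mul_neg, neg_le_neg_iff, mul_one_div,
      le_div_iff₀ hc0, mul_comm]
    refine le_trans ?_ ht
    gcongr
    exact le_max_right _ _
  have h4 : (48 : ℝ) ≤ Real.exp 4 := by
    have h5 : Real.exp 4 = Real.exp 1 ^ 4 := by rw [← Real.exp_nat_mul]; norm_num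
    rw [h5]
    calc (48 : ℝ) ≤ 2.7 ^ 4 := by norm_num
      _ ≤ _ := by
        gcongr
        exact le_trans (by norm_num) Real.exp_one_gt_d9.le
  calc 48 * D * (1 - 1 / c) ^ t
      ≤ 48 * D * Real.exp (-(4 + Real.log (D / ε))) := by gcongr
    _ = 48 * ε / Real.exp 4 := by
        rw [neg_add, Real.exp_add, Real.exp_neg, Real.exp_neg, Real.exp_log (by positivity)]
        field_simp
    _ ≤ ε := by
        rw [div_le_iff₀ (Real.exp_pos 4), mul_comm]
        gcongr

end Convergence
end TokenGD

theorem theorem2 :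
    ∃ C : ℝ, 0 < C ∧
      ∀ (d n K : ℕ) (_hK : 1 ≤ K) (_hKn : K ≤ n)
        (σ L α : ℝ) (_hσ : 0 < σ) (_hL : 0 < L)
        -- the choice of the parameter `α` of the algorithm
        (_hα : α = 2 * K / (L + TokenGD.sigmaTilde n K σ) ∨ (σ ≤ L ∧ α = 2 * K / L))
        (f : Fin n → TokenGD.Vec d → ℝ)
        (_hconv : ∀ i, ConvexOn ℝ Set.univ (f i))
        (_hsmooth : ∀ i, TokenGD.LSmooth L (f i))
        (θs : TokenGD.Vec d) (_hθs : IsMinOn (TokenGD.objective σ f) Set.univ θs)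
        (z₀ : Fin n → TokenGD.Vec d)
        (Ω : Type*) [MeasurableSpace Ω] (P : Measure Ω) [IsProbabilityMeasure P]
        (a : ℕ → Ω → TokenGD.Action n K)
        (_ha : TokenGD.IsSampling P (1 / 2) (1 / 2) a)
        (ε : ℝ) (_hε : 0 < ε),
        ∃ T : ℕ,
          -- accuracy `ε` is reached by every token after `T` iterations, and is kept
          (∀ t, T ≤ t → ∀ k : Fin K,
            Integrable (fun ω =>
              ‖(TokenGD.iterate σ L α (1 / 2) (1 / 2) f z₀ (fun s => a s ω) t).token k
                - θs‖ ^ 2) P ∧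
            ∫ ω, ‖(TokenGD.iterate σ L α (1 / 2) (1 / 2) f z₀ (fun s => a s ω) t).token k
                - θs‖ ^ 2 ∂P ≤ ε) ∧
          -- expected number of gradient steps of each node
          (∀ i : Fin n,
            ∫ ω, (TokenGD.gradSteps (fun s => a s ω) i T : ℝ) ∂P
              ≤ C * (TokenGD.condNumber L σ
                  * (1 + Real.posLog (TokenGD.initGap σ L f z₀ θs / ε)))) ∧
          -- expected number of jumps of each token
          (∀ k : Fin K,
            ∫ ω, (TokenGD.tokenJumps (fun s => a s ω) k T : ℝ) ∂P
              ≤ C * ((n : ℝ) / K * TokenGD.condNumber L σ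
                  * (1 + Real.posLog (TokenGD.initGap σ L f z₀ θs / ε)))) ∧
          -- the expected total communication is of the order obtained with a single token
          ∫ ω, (TokenGD.totalComms (fun s => a s ω) T : ℝ) ∂P
              ≤ C * (n * TokenGD.condNumber L σ
                  * (1 + Real.posLog (TokenGD.initGap σ L f z₀ θs / ε))) ∧
          -- and it is shared equally among the `K` tokens
          (∀ k : Fin K,
            ∫ ω, (TokenGD.tokenJumps (fun s => a s ω) k T : ℝ) ∂P
              = (∫ ω, (TokenGD.totalComms (fun s => a s ω) T : ℝ) ∂P) / K) := by
  refine ⟨200, by norm_num, ?_⟩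
  intro d n K hK hKn σ L α hσ hL hα f hconv hsmooth θs hθs z₀ Ω _ P _ a ha ε hε
  have hK0 : 0 < K := hK
  have hn : 0 < n := hK0.trans_le hKn
  have hn' : (1 : ℝ) ≤ n := Nat.one_le_cast.2 hn
  have hK' : (0 : ℝ) < K := Nat.cast_pos.2 hK0
  have hD : 0 ≤ TokenGD.initGap σ L f z₀ θs := by unfold TokenGD.initGap; positivity
  have hκ : 1 ≤ TokenGD.condNumber L σ := by
    rw [TokenGD.condNumber, le_add_iff_nonneg_right]
    positivity
  have hl : 0 ≤ Real.posLog (TokenGD.initGap σ L f z₀ θs / ε) := Real.posLog_nonneg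
  set κ := TokenGD.condNumber L σ with hκdef
  set l := Real.posLog (TokenGD.initGap σ L f z₀ θs / ε) with hldef
  have hnκ : 1 ≤ n * κ := one_le_mul_of_one_le_of_one_le hn' hκ
  have hc : (1 : ℝ) ≤ 48 * n * κ := by linarith
  -- The contraction factor per iteration is `1 - 1 / (48 n κ)`.
  set T := ⌈48 * n * κ * (4 + l)⌉₊ with hT
  have hTle : (T : ℝ) ≤ 200 * (n * κ * (1 + l)) := by
    have h1 : (T : ℝ) < 48 * n * κ * (4 + l) + 1 := Nat.ceil_lt_add_one (by positivity)
    have h2 : 0 ≤ n * κ * l := by positivity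
    nlinarith
  refine ⟨T, fun t ht k => ⟨?_, ?_⟩, fun i => ?_, fun k => ?_, ?_, fun k => ?_⟩
  · exact TokenGD.integrable_iterate hn ha σ L α f z₀ t fun s => ‖s.token k - θs‖ ^ 2
  · refine (TokenGD.integral_norm_token_sub_sq_le hK0 hKn hσ hL hα hconv hsmooth hθs z₀ ha t
      k).trans (TokenGD.mul_one_sub_pow_le hD hε hc ?_)
    exact (Nat.le_ceil _).trans (Nat.cast_le.2 ht)
  · rw [TokenGD.integral_gradSteps ha]
    calc (T : ℝ) * (1 / 2 / n) ≤ 200 * (n * κ * (1 + l)) * (1 / 2 / n) := by gcongr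
      _ = 100 * (κ * (1 + l)) := by field_simp; norm_num
      _ ≤ 200 * (κ * (1 + l)) := by gcongr; norm_num
  · rw [TokenGD.integral_tokenJumps ha hn]
    calc (T : ℝ) * (1 / 2 / K) ≤ 200 * (n * κ * (1 + l)) * (1 / 2 / K) := by gcongr
      _ = 100 * (n / K * κ * (1 + l)) := by field_simp; norm_num
      _ ≤ 200 * (n / K * κ * (1 + l)) := by gcongr; norm_num
  · rw [TokenGD.integral_totalComms ha hn hK0]
    have : (0 : ℝ) ≤ T := Nat.cast_nonneg T
    linarith
  · rw [TokenGD.integral_tokenJumps ha hn, TokenGD.integral_totalComms ha hn hK0, mul_div_assoc]
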